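/- Let $\Gamma$ be a divisible totally ordered abelian group (possibly trivial), written additively. Let $\mathbb{T}_{\max}=(\Gamma\cup\{\bot\},\max,+)$ be the tropical semifield over $\Gamma$, with zero $\mathbb{0}=\bot$ and unit $\mathbb{1}=0$. Let $\mathbb{S}_{\max}$ be the symmetrized tropical semiring: the quotient of $\mathbb{T}_{\max}^2$, with operations $(a_1,a_2)\oplus(b_1,b_2)=(a_1\oplus b_1,a_2\oplus b_2)$ and $(a_1,a_2)\odot(b_1,b_2)=(a_1b_1\oplus a_2b_2,\;a_1b_2\oplus a_2b_1)$, by the congruence which identifies $(a_1,a_2)$ and $(b_1,b_2)$ if they are equal, or if $a_1\ne a_2$, $b_1\neq b_2$ and $a_1\oplus b_2=a_2\oplus b_1$. It carries the maps $\ominus\overline{(a_1,a_2)}=\overline{(a_2,a_1)}$ and $|\overline{(a_1,a_2)}|=a_1\oplus a_2\in\mathbb{T}_{\max}$, and the balance relation $\overline{(a_1,a_2)}\,\nabla\,\overline{(b_1,b_2)}\iff a_1\oplus b_2=a_2\oplus b_1$. Identify $c\in\mathbb{T}_{\max}$ with $\overline{(c,\bot)}$; let $\mathbb{S}_{\max}^{\oplus}$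 be the set of these elements, $\mathbb{S}_{\max}^{\ominus}=\{\ominus a: a\in \mathbb{S}_{\max}^{\oplus}\}$, and let $\mathbb{S}_{\max}^\vee=\mathbb{S}_{\max}^{\oplus}\cup\mathbb{S}_{\max}^{\ominus}$ be the set of signed elements. For a formal polynomial $P=\bigoplus_k P_k\mathsf{Y}^k$ write $\widehat P$ for its polynomial function, and $|P|=\bigoplus_k|P_k|\mathsf{Y}^k$. For $P\in\mathbb{S}_{\max}^\vee[\mathsf{Y}]$ (all coefficients signed), a signed $a$ is a root of $P$ if $\widehat P(a)\,\nabla\,\mathbb{0}$. The multiplicity $\mathrm{mult}_a(P)$ is $0$ if $a$ is not a root of $P$, and otherwise $$\mathrm{mult}_a(P)=1+\max\{\mathrm{mult}_a(Q) : Q\in\mathbb{S}_{\max}^\vee[\mathsf{Y}],\ \lambda P\,\nabla\,(\mathsf{Y}\ominus a)Q \text{ coefficientwise for some } \lambda\in\mathbb{S}_{\max}^\vee\setminus\{\mathbb{0}\}\}.$$ $P$ has $n$ roots counted with multiplicity if there are $r_1,\dots,r_n\in\mathbb{S}_{\max}^\vee$ such that every $a\in\mathbb{S}_{\max}^\vee$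 occurs exactly $\mathrm{mult}_a(P)$ times among them. A non-zero corner of $|P|$ is a $c\in\Gamma$ at which the maximum $\widehat{|P|}(c)=\bigoplus_k|P_k|\odot c^{\odot k}$ is attained by at least two different monomials of $|P|$. For such $c$ let $\mathrm{sat}(c,P)=\{i\in\{0,\dots,\deg P\} : |\widehat P(c)|=|P_i|\odot c^{\odot i}\}$ and $$P^{\mathrm{sat},c}=\bigoplus_{i\in\mathrm{sat}(c,P)}|\widehat P(c)|^{\odot-1}\odot c^{\odot i}\odot P_i\,\mathsf{Y}^i .$$ Call $k<\ell$ successive degrees of a polynomial $Q$ if $Q_k\neq\mathbb{0}$, $Q_\ell\ne\mathbb{0}$, and $Q_i=\mathbb{0}$ for $k<i<\ell$. **Theorem.** Let $P\in\mathbb{S}_{\max}^\vee[\mathsf{Y}]$ have degree $n$ (so $P\neq \mathbb{0}$). Then $P$ has $n$ roots counted with multiplicity if and only if, for all non-zero corners $c$ of $|P|$ and all successive degrees $k<\ell$ of $P^{\mathrm{sat},c}$, either $\ell-k=1$, or $\ell-k=2$ and $P^{\mathrm{sat},c}_\ell=\ominus P^{\mathrm{sat},c}_k$. Moreover, for all such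 $c$, $k$ and $\ell$, the condition $P^{\mathrm{sat},c}_\ell=\ominus P^{\mathrm{sat},c}_k$ is equivalent to $P_\ell\odot P_k\in\mathbb{S}_{\max}^{\ominus}$. -/

import Mathlib

noncomputable section

/-! ### The tropical semifield -/

/-- The tropical semifield `T_max(Γ) = (Γ ∪ {⊥}, max, +)` over an ordered abelian group `Γ`.
The underlying ordered set is `Γ` with a bottom element adjoined.  It is written multiplicatively:
`*` is the addition of `Γ`, `1` is the zero of `Γ`, `0` is the bottom element `⊥`, and `+` is
the maximum. -/
def Tmax (Γ : Type*) : Type _ := WithZero (Multiplicative Γ)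

namespace Tmax

variable {Γ : Type*} [AddCommGroup Γ] [LinearOrder Γ] [IsOrderedAddMonoid Γ]

instance : LinearOrderedCommGroupWithZero (Tmax Γ) :=
  inferInstanceAs (LinearOrderedCommGroupWithZero (WithZero (Multiplicative Γ)))

instance : Add (Tmax Γ) := ⟨max⟩

instance : CommSemiring (Tmax Γ) where
  add_assoc := max_assoc
  add_comm := max_comm
  zero_add a := max_eq_right (zero_le (a := a))
  add_zero a := max_eq_left (zero_le (a := a))
  nsmul := nsmulRec
  left_distrib a b c := Monotone.map_max (f := fun x => a * x) fun _ _ h => mul_le_mul_right h a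
  right_distrib a b c := Monotone.map_max (f := fun x => x * c) fun _ _ h => mul_le_mul_left h c
  zero_mul := zero_mul
  mul_zero := mul_zero
  mul_assoc := mul_assoc
  one_mul := one_mul
  mul_one := mul_one
  mul_comm := mul_comm
  npow n a := a ^ n
  npow_zero := pow_zero
  npow_succ n a := pow_succ a n

theorem add_eq_max (a b : Tmax Γ) : a + b = max a b := rfl

end Tmax

/-! ### Pairs of tropical numbers -/

/-- The semiring `T_max × T_max` with the multiplication of formal differences. -/
@[ext] structure TmaxPair (Γ : Type*) where
  fst : Tmax Γ
  snd : Tmax Γ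

namespace TmaxPair

variable {Γ : Type*} [AddCommGroup Γ] [LinearOrder Γ] [IsOrderedAddMonoid Γ]

instance : Zero (TmaxPair Γ) := ⟨⟨0, 0⟩⟩
instance : One (TmaxPair Γ) := ⟨⟨1, 0⟩⟩
instance : Add (TmaxPair Γ) := ⟨fun a b => ⟨a.fst + b.fst, a.snd + b.snd⟩⟩
instance : Mul (TmaxPair Γ) :=
  ⟨fun a b => ⟨a.fst * b.fst + a.snd * b.snd, a.fst * b.snd + a.snd * b.fst⟩⟩

@[simp] theorem zero_fst : (0 : TmaxPair Γ).fst = 0 := rfl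
@[simp] theorem zero_snd : (0 : TmaxPair Γ).snd = 0 := rfl
@[simp] theorem one_fst : (1 : TmaxPair Γ).fst = 1 := rfl
@[simp] theorem one_snd : (1 : TmaxPair Γ).snd = 0 := rfl
@[simp] theorem add_fst (a b : TmaxPair Γ) : (a + b).fst = a.fst + b.fst := rfl
@[simp] theorem add_snd (a b : TmaxPair Γ) : (a + b).snd = a.snd + b.snd := rfl
@[simp] theorem mul_fst (a b : TmaxPair Γ) :
    (a * b).fst = a.fst * b.fst + a.snd * b.snd := rfl
@[simp] theorem mul_snd (a b : TmaxPair Γ) :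
    (a * b).snd = a.fst * b.snd + a.snd * b.fst := rfl

instance : CommSemiring (TmaxPair Γ) where
  add_assoc a b c := by ext <;> simp <;> ring
  zero_add a := by ext <;> simp
  add_zero a := by ext <;> simp
  add_comm a b := by ext <;> simp <;> ring
  nsmul := nsmulRec
  left_distrib a b c := by ext <;> simp <;> ring
  right_distrib a b c := by ext <;> simp <;> ring
  zero_mul a := by ext <;> simp
  mul_zero a := by ext <;> simp
  mul_assoc a b c := by ext <;> simp <;> ring
  one_mul a := by ext <;> simp
  mul_one a := by ext <;> simp
  mul_comm a b := by ext <;> simp <;> ring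

/-- The minus operator `⊖ (a₁, a₂) = (a₂, a₁)`. -/
def neg (a : TmaxPair Γ) : TmaxPair Γ := ⟨a.snd, a.fst⟩

/-- The balance relation on pairs: `a₁ ⊕ b₂ = a₂ ⊕ b₁`. -/
def Balance (a b : TmaxPair Γ) : Prop := a.fst + b.snd = a.snd + b.fst

/-- The relation by which `T_max × T_max` is divided: the balance relation between two pairs
with distinct components, and equality otherwise. -/
def Rel (a b : TmaxPair Γ) : Prop :=
  (a.fst ≠ a.snd ∧ b.fst ≠ b.snd ∧ Balance a b) ∨
    (¬ (a.fst ≠ a.snd ∧ b.fst ≠ b.snd) ∧ a = b)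

theorem rel_iff (a b : TmaxPair Γ) : Rel a b ↔
    (a.snd < a.fst ∧ b.snd < b.fst ∧ a.fst = b.fst) ∨
    (a.fst < a.snd ∧ b.fst < b.snd ∧ a.snd = b.snd) ∨ a = b := by
  obtain ⟨a1, a2⟩ := a
  obtain ⟨b1, b2⟩ := b
  simp only [Rel, Balance, Tmax.add_eq_max, TmaxPair.mk.injEq]
  grind

theorem rel_equivalence : Equivalence (Rel (Γ := Γ)) := by
  refine ⟨fun a => ?_, fun {a b} h => ?_, fun {a b c} h h' => ?_⟩
  · rw [rel_iff]; tauto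
  · rw [rel_iff] at *; grind
  · rw [rel_iff] at *; grind

theorem rel_add_right {a b : TmaxPair Γ} (h : Rel a b) (c : TmaxPair Γ) :
    Rel (a + c) (b + c) := by
  obtain ⟨a1, a2⟩ := a
  obtain ⟨b1, b2⟩ := b
  obtain ⟨c1, c2⟩ := c
  rw [rel_iff] at *
  simp only [add_fst, add_snd, Tmax.add_eq_max, TmaxPair.ext_iff] at *
  grind

theorem rel_mul_right {a b : TmaxPair Γ} (h : Rel a b) (c : TmaxPair Γ) :
    Rel (a * c) (b * c) := by
  obtain ⟨a1, a2⟩ := a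
  obtain ⟨b1, b2⟩ := b
  obtain ⟨c1, c2⟩ := c
  have lt : ∀ {x y z : Tmax Γ}, x < y → z ≠ 0 → x * z < y * z := fun hxy hz =>
    mul_lt_mul_of_pos_right hxy (zero_lt_iff.2 hz)
  have lt' : ∀ {x y z : Tmax Γ}, x < y → z ≠ 0 → z * x < z * y := fun hxy hz =>
    mul_lt_mul_of_pos_left hxy (zero_lt_iff.2 hz)
  have ne : ∀ {x y : Tmax Γ}, x < y → y ≠ 0 := fun hxy => (lt_of_le_of_lt zero_le hxy).ne'
  rw [rel_iff] at *
  simp only [mul_fst, mul_snd, Tmax.add_eq_max, TmaxPair.ext_iff] at *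
  rcases h with ⟨h1, h2, rfl⟩ | ⟨h1, h2, rfl⟩ | ⟨rfl, rfl⟩
  · rcases lt_trichotomy c1 c2 with h | rfl | h
    · have := lt h1 (ne h); have := lt h2 (ne h); have := lt' h (ne h1)
      have := lt_of_le_of_lt (mul_le_mul_right h.le a2) (lt h1 (ne h))
      have := lt_of_le_of_lt (mul_le_mul_right h.le b2) (lt h2 (ne h))
      grind
    · have := mul_le_mul_left h1.le c1; have := mul_le_mul_left h2.le c1
      grind
    · have := lt h1 (ne h); have := lt h2 (ne h); have := lt' h (ne h1)
      have := lt_of_le_of_lt (mul_le_mul_right h.le a2) (lt h1 (ne h))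
      have := lt_of_le_of_lt (mul_le_mul_right h.le b2) (lt h2 (ne h))
      grind
  · rcases lt_trichotomy c1 c2 with h | rfl | h
    · have := lt h1 (ne h); have := lt h2 (ne h); have := lt' h (ne h1)
      have := lt_of_le_of_lt (mul_le_mul_right h.le a1) (lt h1 (ne h))
      have := lt_of_le_of_lt (mul_le_mul_right h.le b1) (lt h2 (ne h))
      grind
    · have := mul_le_mul_left h1.le c1; have := mul_le_mul_left h2.le c1
      grind
    · have := lt h1 (ne h); have := lt h2 (ne h); have := lt' h (ne h1)
      have := lt_of_le_of_lt (mul_le_mul_right h.le a1) (lt h1 (ne h))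
      have := lt_of_le_of_lt (mul_le_mul_right h.le b1) (lt h2 (ne h))
      grind
  · simp

theorem rel_neg {a b : TmaxPair Γ} (h : Rel a b) : Rel a.neg b.neg := by
  obtain ⟨a1, a2⟩ := a
  obtain ⟨b1, b2⟩ := b
  rw [rel_iff] at *
  simp only [neg, TmaxPair.mk.injEq] at *
  tauto

theorem rel_balance {a b a' b' : TmaxPair Γ} (h : Rel a a') (h' : Rel b b') :
    Balance a b = Balance a' b' := by
  obtain ⟨a1, a2⟩ := a
  obtain ⟨b1, b2⟩ := b
  rw [rel_iff] at *
  simp only [Balance, Tmax.add_eq_max, eq_iff_iff] at *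
  grind

variable (Γ) in
/-- `Rel` is a congruence for both operations. -/
def con : RingCon (TmaxPair Γ) where
  r := Rel
  iseqv := rel_equivalence
  add' {a b c d} h h' := by
    refine rel_equivalence.trans (rel_add_right h c) ?_
    rw [add_comm b c, add_comm b d]
    exact rel_add_right h' b
  mul' {a b c d} h h' := by
    refine rel_equivalence.trans (rel_mul_right h c) ?_
    rw [mul_comm b c, mul_comm b d]
    exact rel_mul_right h' b

/-- The absolute value `|(a₁, a₂)| = a₁ ⊕ a₂`, a morphism of semirings. -/
def absHom : TmaxPair Γ →+* Tmax Γ where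
  toFun a := a.fst + a.snd
  map_zero' := by simp
  map_one' := by simp
  map_add' a b := by simp only [add_fst, add_snd]; ring
  map_mul' a b := by simp only [mul_fst, mul_snd]; ring

theorem rel_abs {a b : TmaxPair Γ} (h : Rel a b) : absHom a = absHom b := by
  rw [rel_iff] at h
  simp only [absHom, RingHom.coe_mk, MonoidHom.coe_mk, OneHom.coe_mk, Tmax.add_eq_max]
  grind

end TmaxPair

/-! ### The symmetrized tropical semiring -/

/-- The symmetrized tropical semiring `S_max(Γ)`, the quotient of the semiring
`T_max × T_max` by the congruence `TmaxPair.Rel`. -/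
abbrev Smax (Γ : Type*) [AddCommGroup Γ] [LinearOrder Γ] [IsOrderedAddMonoid Γ] : Type _ :=
  (TmaxPair.con Γ).Quotient

namespace Smax

variable {Γ : Type*} [AddCommGroup Γ] [LinearOrder Γ] [IsOrderedAddMonoid Γ]

/-- The class of the pair `(a₁, a₂)`. -/
def mk (a₁ a₂ : Tmax Γ) : Smax Γ := (TmaxPair.con Γ).mk' ⟨a₁, a₂⟩

/-- The minus operator `⊖`. -/
def neg : Smax Γ → Smax Γ :=
  Quotient.map TmaxPair.neg fun _ _ h => TmaxPair.rel_neg h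

/-- The balance relation `∇`. -/
def Balance : Smax Γ → Smax Γ → Prop :=
  Quotient.lift₂ TmaxPair.Balance fun _ _ _ _ h h' => TmaxPair.rel_balance h h'

/-- The absolute value `|a|`, a morphism of semirings to `T_max`. -/
def abs : Smax Γ →+* Tmax Γ :=
  (TmaxPair.con Γ).lift TmaxPair.absHom fun _ _ h => TmaxPair.rel_abs h

/-- The identification of `c ∈ T_max` with the class of `(c, ⊥)`. -/
def ofTmax (c : Tmax Γ) : Smax Γ := mk c 0

variable (Γ) in
/-- The set of positive or zero elements. -/
def nonneg : Set (Smax Γ) := {a | ∃ c : Tmax Γ, a = mk c 0}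

variable (Γ) in
/-- The set of negative or zero elements. -/
def nonpos : Set (Smax Γ) := {a | ∃ c : Tmax Γ, a = mk 0 c}

variable (Γ) in
/-- The set `S_max^∨` of signed elements: positive, negative or zero. -/
def signed : Set (Smax Γ) := nonneg Γ ∪ nonpos Γ

end Smax

/-! ### Corners of polynomials over the tropical semifield

Formal polynomials are elements of Mathlib's `Polynomial`; the associated polynomial function of
`P` is `fun y => P.eval y`. -/

/-- `c` is a corner of the formal polynomial `P` over `T_max`: for `c ≠ 0`, the maximum
`P.eval c = ⨁ₖ Pₖ cᵏ` is attained by two different monomials of `P`; for `c = 0`, `P` has no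
constant term. -/
def Tmax.IsCorner {Γ : Type*} [AddCommGroup Γ] [LinearOrder Γ] [IsOrderedAddMonoid Γ]
    (P : Polynomial (Tmax Γ)) (c : Tmax Γ) : Prop :=
  (c ≠ 0 ∧ ∃ i ∈ P.support, ∃ j ∈ P.support, i ≠ j ∧
      P.coeff i * c ^ i = P.eval c ∧ P.coeff j * c ^ j = P.eval c) ∨
    (c = 0 ∧ P.coeff 0 = 0)

/-- `k < l` are successive degrees of non-zero monomials of `P`. -/
def SuccessiveDegrees {R : Type*} [Semiring R] (P : Polynomial R) (k l : ℕ) : Prop :=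
  k < l ∧ P.coeff k ≠ 0 ∧ P.coeff l ≠ 0 ∧ ∀ i, k < i → i < l → P.coeff i = 0

/-! ### Polynomials over the symmetrized tropical semiring -/

namespace Smax

variable {Γ : Type*} [AddCommGroup Γ] [LinearOrder Γ] [IsOrderedAddMonoid Γ]

/-- All coefficients of `P` are signed, that is `P ∈ S_max^∨[Y]`. -/
def IsSignedPoly (P : Polynomial (Smax Γ)) : Prop := ∀ k, P.coeff k ∈ signed Γ

/-- The coefficientwise balance relation. -/
def PolyBalance (P Q : Polynomial (Smax Γ)) : Prop := ∀ k, Balance (P.coeff k) (Q.coeff k)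

/-- The coefficientwise absolute value `|P|`. -/
def absPoly (P : Polynomial (Smax Γ)) : Polynomial (Tmax Γ) := P.map abs

/-- The value of `P` at `a` balances zero. For signed `a`, this says that `a` is a root of `P`. -/
def IsRootOf (a : Smax Γ) (P : Polynomial (Smax Γ)) : Prop := Balance (P.eval a) 0

/-- `Q ∈ S_max^∨[Y]` satisfies `λ P ∇ (Y ⊖ a) Q` for some non-zero signed `λ`. -/
def IsQuotientBy (a : Smax Γ) (P Q : Polynomial (Smax Γ)) : Prop :=
  IsSignedPoly Q ∧ ∃ t ∈ signed Γ, t ≠ 0 ∧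
    PolyBalance (Polynomial.C t * P) ((Polynomial.X + Polynomial.C (neg a)) * Q)

/-- `MultGE a m P` says that the multiplicity of `a` in `P` is at least `m`. -/
def MultGE (a : Smax Γ) : ℕ → Polynomial (Smax Γ) → Prop
  | 0, _ => True
  | m + 1, P => IsRootOf a P ∧ (m = 0 ∨ ∃ Q, IsQuotientBy a P Q ∧ MultGE a m Q)

/-- The multiplicity of `a` as a root of `P`. It satisfies the recursion: it is `0` if `a` is not
a root of `P`, and `1` plus the supremum of the multiplicities of `a` in the polynomials `Q` with
`IsQuotientBy a P Q` otherwise (see `mult_of_not_isRootOf` and `mult_of_isRootOf`). -/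
def mult (a : Smax Γ) (P : Polynomial (Smax Γ)) : ℕ∞ := ⨆ (m : ℕ) (_ : MultGE a m P), (m : ℕ∞)

theorem mult_of_not_isRootOf {a : Smax Γ} {P : Polynomial (Smax Γ)} (h : ¬ IsRootOf a P) :
    mult a P = 0 := by
  refine le_antisymm (iSup₂_le fun m hm => ?_) zero_le
  cases m with
  | zero => simp
  | succ m => exact absurd hm.1 h

theorem mult_of_isRootOf {a : Smax Γ} {P : Polynomial (Smax Γ)} (h : IsRootOf a P) :
    mult a P = 1 + ⨆ (Q : Polynomial (Smax Γ)) (_ : IsQuotientBy a P Q), mult a Q := by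
  apply le_antisymm
  · refine iSup₂_le fun m hm => ?_
    cases m with
    | zero => simp
    | succ m =>
      rw [Nat.cast_add, Nat.cast_one, add_comm]
      gcongr
      rcases hm.2 with rfl | ⟨Q, hQ, hm⟩
      · simp
      · exact le_iSup₂_of_le Q hQ (le_iSup₂_of_le (f := fun (m : ℕ) (_ : MultGE a m Q) =>
          (m : ℕ∞)) m hm le_rfl)
  · have h1 : (1 : ℕ∞) ≤ mult a P :=
      le_iSup₂_of_le (f := fun (m : ℕ) (_ : MultGE a m P) => (m : ℕ∞)) 1 ⟨h, Or.inl rfl⟩ (by simp)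
    rw [← tsub_add_cancel_of_le h1, add_comm (_ - _)]
    gcongr
    refine iSup₂_le fun Q hQ => iSup₂_le fun m hm => ?_
    refine ENat.le_sub_of_add_le_left (by simp) ?_
    exact le_iSup₂_of_le (f := fun (m : ℕ) (_ : MultGE a m P) => (m : ℕ∞)) (m + 1)
      ⟨h, Or.inr ⟨Q, hQ, hm⟩⟩ (by simp [add_comm])

open Classical in
/-- `P` has `n` roots counted with multiplicity: there are signed `r₁, …, rₙ` in which each signed
`a` occurs exactly as often as its multiplicity as a root of `P`. -/
def HasRootsWithMult (P : Polynomial (Smax Γ)) (n : ℕ) : Prop :=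
  ∃ r : Fin n → Smax Γ, (∀ i, r i ∈ signed Γ) ∧
    ∀ a ∈ signed Γ, ((Finset.univ.filter fun i => r i = a).card : ℕ∞) = mult a P

open Classical in
/-- The saturation set of `P` at `r`: the degrees `i` with `|P.eval r| = |Pᵢ| |r|ⁱ`. -/
def sat (r : Smax Γ) (P : Polynomial (Smax Γ)) : Finset ℕ :=
  (Finset.range (P.natDegree + 1)).filter fun i =>
    abs (P.eval r) = abs (P.coeff i) * abs r ^ i

/-- The saturation polynomial of `P` at `r`: the monomials with degree `i` in the saturation set,
with coefficients `|P.eval r|⁻¹ rⁱ Pᵢ`. -/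
def satPoly (P : Polynomial (Smax Γ)) (r : Smax Γ) : Polynomial (Smax Γ) :=
  ∑ i ∈ sat r P, Polynomial.monomial i (ofTmax (abs (P.eval r))⁻¹ * r ^ i * P.coeff i)

end Smax

end

/-!
The multiplicity of a non-zero signed `a` as a root of `P` is the number of sign changes in the
sequence of the terms `Pₖ aᵏ` of maximal absolute value, because every division by `Y ⊖ a` loses at
least one sign change and some division loses exactly one. Replacing `a` by `⊖ a` toggles the sign
change between two successive degrees `k < l` of such terms exactly when `l - k` is odd. So at a
corner `c` the two elements `c` and `⊖ c` together receive from the pair `k, l` the multiplicity `1`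
if `l - k` is odd, and `0` or `2` if `l - k` is even, which is at most `l - k`. By divisibility
every edge of the Newton polygon of `|P|` has its slope in `Γ`, so the widths `l - k` and the
multiplicity of the root `⊥` add up to `deg P`. There are therefore `deg P` roots if and only if all
these bounds are attained.
-/

/-! ### Finite subsets of linear orders and finite families -/

section ConsecutivePairs

open Finset

variable {ι α β : Type*} [LinearOrder ι]

/-- The pairs of successive elements of a finite subset of a linear order. -/
def consecutivePairs (D : Finset ι) : Finset (ι × ι) :=
  (D ×ˢ D).filter fun p => p.1 < p.2 ∧ ∀ i ∈ D, i ≤ p.1 ∨ p.2 ≤ i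

open Classical in
/-- The pairs of successive elements of `D` at which `f` takes two different values. -/
noncomputable def jumps (D : Finset ι) (f : ι → α) : Finset (ι × ι) :=
  (consecutivePairs D).filter fun p => f p.1 ≠ f p.2

open Classical in
/-- The elements at which the maximal intervals of `D` with constant `f` begin. -/
noncomputable def runStarts (D : Finset ι) (f : ι → α) : Finset ι :=
  D.filter fun l => ∀ p ∈ consecutivePairs D, p.2 = l → f p.1 ≠ f l

variable {D T : Finset ι} {f : ι → α} {a b x : ι} {p q : ι × ι}

theorem mem_consecutivePairs : p ∈ consecutivePairs D ↔
    p.1 ∈ D ∧ p.2 ∈ D ∧ p.1 < p.2 ∧ ∀ i ∈ D, i ≤ p.1 ∨ p.2 ≤ i := by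
  simp [consecutivePairs, and_assoc]

theorem mem_jumps : p ∈ jumps D f ↔ p ∈ consecutivePairs D ∧ f p.1 ≠ f p.2 := by
  simp [jumps]

theorem mem_runStarts : a ∈ runStarts D f ↔
    a ∈ D ∧ ∀ p ∈ consecutivePairs D, p.2 = a → f p.1 ≠ f a := by
  simp [runStarts]

theorem jumps_comp {g : α → β} (hg : ∀ i ∈ D, ∀ j ∈ D, g (f i) = g (f j) → f i = f j) :
    jumps D (fun i => g (f i)) = jumps D f := by
  ext p
  simp only [mem_jumps, mem_consecutivePairs]
  refine and_congr_right fun hp => not_congr ⟨hg _ hp.1 _ hp.2.1, congrArg g⟩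

theorem exists_mem_consecutivePairs (ha : a ∈ D) (hb : b ∈ D) (hax : a < x) (hxb : x ≤ b) :
    ∃ p ∈ consecutivePairs D, p.1 < x ∧ x ≤ p.2 := by
  obtain ⟨k, hk, hk_max⟩ := exists_max_image (D.filter (· < x)) id ⟨a, by simp [ha, hax]⟩
  obtain ⟨l, hl, hl_min⟩ := exists_min_image (D.filter (x ≤ ·)) id ⟨b, by simp [hb, hxb]⟩
  simp only [mem_filter, id_eq, and_imp] at hk hl hk_max hl_min
  refine ⟨(k, l), mem_consecutivePairs.2 ⟨hk.1, hl.1, hk.2.trans_le hl.2, fun i hi => ?_⟩,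
    hk.2, hl.2⟩
  exact (lt_or_ge i x).imp (hk_max i hi) (hl_min i hi)

theorem eq_of_mem_consecutivePairs (hp : p ∈ consecutivePairs D) (hq : q ∈ consecutivePairs D)
    (hp₁ : p.1 < x) (hp₂ : x ≤ p.2) (hq₁ : q.1 < x) (hq₂ : x ≤ q.2) : p = q := by
  rw [mem_consecutivePairs] at hp hq
  have := hp.2.2.2 q.1 hq.1
  have := hp.2.2.2 q.2 hq.2.1
  have := hq.2.2.2 p.1 hp.1
  have := hq.2.2.2 p.2 hp.2.1
  ext <;> grind

theorem injOn_snd_consecutivePairs : Set.InjOn Prod.snd (consecutivePairs D : Set (ι × ι)) :=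
  fun _ hp _ hq hpq => eq_of_mem_consecutivePairs hp hq (mem_consecutivePairs.1 hp).2.2.1 le_rfl
    (hpq ▸ (mem_consecutivePairs.1 hq).2.2.1) hpq.le

theorem exists_consecutivePair_snd_eq (ha : a ∈ D) (hb : b ∈ D) (hab : a < b) :
    ∃ p ∈ consecutivePairs D, p.2 = b ∧ a ≤ p.1 := by
  obtain ⟨p, hp, hp₁, hp₂⟩ := exists_mem_consecutivePairs ha hb hab le_rfl
  have h := mem_consecutivePairs.1 hp
  refine ⟨p, hp, ?_, ?_⟩
  · exact ((h.2.2.2 b hb).resolve_left hp₁.not_ge).antisymm hp₂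
  · exact (h.2.2.2 a ha).resolve_right (hab.trans_le hp₂).not_ge

theorem card_le_card_consecutivePairs_add_one : #D ≤ #(consecutivePairs D) + 1 := by
  rcases D.eq_empty_or_nonempty with rfl | hD
  · simp
  · rw [← card_erase_add_one (D.min'_mem hD)]
    gcongr
    refine (card_le_card fun b hb => ?_).trans (card_image_le (f := Prod.snd))
    obtain ⟨hb_ne, hb⟩ := mem_erase.1 hb
    obtain ⟨p, hp, hpb, -⟩ := exists_consecutivePair_snd_eq (D.min'_mem hD) hb
      ((D.min'_le b hb).lt_of_ne hb_ne.symm)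
    exact mem_image.2 ⟨p, hp, hpb⟩

theorem exists_jump (ha : a ∈ D) (hb : b ∈ D) (hab : a < b) (hf : f a ≠ f b) :
    ∃ p ∈ jumps D f, a ≤ p.1 ∧ p.2 ≤ b := by
  classical
  obtain ⟨l, hl, hl_min⟩ := exists_min_image (D.filter fun i => a < i ∧ f a ≠ f i) id
    ⟨b, by simp [hb, hab, hf]⟩
  simp only [mem_filter, id_eq, and_imp] at hl hl_min
  obtain ⟨p, hp, rfl, hap⟩ := exists_consecutivePair_snd_eq ha hl.1 hl.2.1
  have h := mem_consecutivePairs.1 hp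
  have hfp : f a = f p.1 := by
    by_contra hne
    exact (hl_min p.1 h.1 (hap.lt_of_ne fun h => hne (h ▸ rfl)) hne).not_gt h.2.2.1
  exact ⟨p, mem_jumps.2 ⟨hp, hfp ▸ hl.2.2⟩, hap, hl_min b hb hab hf⟩

theorem card_jumps_le_of_subset (h : T ⊆ D) : #(jumps T f) ≤ #(jumps D f) := by
  have hjump : ∀ p ∈ jumps T f, ∃ q ∈ jumps D f, p.1 ≤ q.1 ∧ q.2 ≤ p.2 := fun p hp => by
    obtain ⟨hp, hf⟩ := mem_jumps.1 hp
    obtain ⟨hp₁, hp₂, hlt, -⟩ := mem_consecutivePairs.1 hp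
    exact exists_jump (h hp₁) (h hp₂) hlt hf
  choose! q hq hq₁ hq₂ using hjump
  refine card_le_card_of_injOn q hq fun p hp p' hp' hqq => ?_
  have hlt := (mem_consecutivePairs.1 (mem_jumps.1 (hq p hp)).1).2.2.1
  exact eq_of_mem_consecutivePairs (mem_jumps.1 hp).1 (mem_jumps.1 hp').1
    ((hq₁ p hp).trans_lt hlt) (hq₂ p hp)
    ((hq₁ p' hp').trans_lt (hqq ▸ hlt)) (hqq ▸ hq₂ p' hp')

theorem exists_runStart_le (hb : b ∈ D) :
    ∃ a ∈ runStarts D f, a ≤ b ∧ f a = f b ∧ ∀ c ∈ runStarts D f, c ≤ b → c ≤ a := by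
  classical
  obtain ⟨a, ha, ha_min⟩ := exists_min_image
    (D.filter fun i => i ≤ b ∧ ∀ j ∈ D, i ≤ j → j ≤ b → f j = f b) id
    ⟨b, by simp only [mem_filter]; exact ⟨hb, le_rfl, fun j _ h h' => by rw [h'.antisymm h]⟩⟩
  simp only [mem_filter, id_eq, and_imp] at ha ha_min
  obtain ⟨haD, hab, hconst⟩ := ha
  have hfa := hconst a haD le_rfl hab
  refine ⟨a, mem_runStarts.2 ⟨haD, ?_⟩, hab, hfa, fun c hc hcb => ?_⟩
  · rintro p hp rfl hfp
    obtain ⟨hp₁, -, hlt, hp⟩ := mem_consecutivePairs.1 hp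
    refine (ha_min p.1 hp₁ (hlt.le.trans hab) fun j hj hpj hjb => ?_).not_gt hlt
    rcases hp j hj with hjp | hjp
    · rw [hjp.antisymm hpj, hfp, hfa]
    · exact hconst j hj hjp hjb
  · by_contra! hac
    obtain ⟨hcD, hc⟩ := mem_runStarts.1 hc
    obtain ⟨p, hp, hpc, hap⟩ := exists_consecutivePair_snd_eq haD hcD hac
    obtain ⟨hp₁, -, hlt, -⟩ := mem_consecutivePairs.1 hp
    refine hc p hp hpc ?_
    rw [hconst c hcD hac.le hcb, hconst p.1 hp₁ hap (hlt.le.trans (hpc ▸ hcb))]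

theorem ne_of_mem_consecutivePairs_runStarts (hp : p ∈ consecutivePairs (runStarts D f)) :
    f p.1 ≠ f p.2 := by
  obtain ⟨hp₁, hp₂, hlt, hp⟩ := mem_consecutivePairs.1 hp
  obtain ⟨hpD, hstart⟩ := mem_runStarts.1 hp₂
  obtain ⟨q, hq, hqp, hpq⟩ := exists_consecutivePair_snd_eq (mem_runStarts.1 hp₁).1 hpD hlt
  obtain ⟨hqD, -, hq_lt, -⟩ := mem_consecutivePairs.1 hq
  obtain ⟨a, ha, haq, hfa, ha_max⟩ := exists_runStart_le (f := f) hqD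
  have hap : a = p.1 := ((hp a ha).resolve_right
    (haq.trans_lt (hqp ▸ hq_lt)).not_ge).antisymm (ha_max p.1 hp₁ hpq)
  rw [← hap, hfa]
  exact hstart q hq hqp

theorem card_jumps_lt_card_runStarts (hD : D.Nonempty) : #(jumps D f) < #(runStarts D f) := by
  classical
  have hmin : D.min' hD ∉ (jumps D f).image Prod.snd := fun h => by
    obtain ⟨p, hp, hpD⟩ := mem_image.1 h
    obtain ⟨hp₁, -, hlt, -⟩ := mem_consecutivePairs.1 (mem_jumps.1 hp).1
    exact (D.min'_le p.1 hp₁).not_gt (hpD ▸ hlt)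
  have hinj : Set.InjOn Prod.snd (jumps D f : Set (ι × ι)) :=
    injOn_snd_consecutivePairs.mono fun p hp => (mem_jumps.1 hp).1
  rw [← card_image_of_injOn hinj, ← Nat.add_one_le_iff, ← card_insert_of_notMem hmin]
  refine card_le_card (insert_subset (mem_runStarts.2 ⟨D.min'_mem hD, ?_⟩) ?_)
  · intro p hp hpD
    obtain ⟨hp₁, -, hlt, -⟩ := mem_consecutivePairs.1 hp
    exact absurd (hpD ▸ hlt) (D.min'_le p.1 hp₁).not_gt
  · rw [image_subset_iff]
    intro p hp
    obtain ⟨hp, hf⟩ := mem_jumps.1 hp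
    refine mem_runStarts.2 ⟨(mem_consecutivePairs.1 hp).2.1, fun q hq hqp => ?_⟩
    rwa [injOn_snd_consecutivePairs hq hp hqp]

end ConsecutivePairs

section Hull

open Finset

variable {ι : Type*} [LinearOrder ι] [LocallyFiniteOrder ι] {D : Finset ι} {x : ι}

/-- The elements lying between two elements of `D`, the least element of `D` excluded. For a set
of degrees its cardinality is the difference of the extreme ones. -/
def hull (D : Finset ι) : Finset ι :=
  (consecutivePairs D).biUnion fun p => Ioc p.1 p.2

theorem mem_hull : x ∈ hull D ↔ ∃ i ∈ D, ∃ j ∈ D, i < x ∧ x ≤ j := by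
  simp only [hull, mem_biUnion, mem_Ioc]
  constructor
  · rintro ⟨p, hp, hx⟩
    obtain ⟨hp₁, hp₂, -⟩ := mem_consecutivePairs.1 hp
    exact ⟨p.1, hp₁, p.2, hp₂, hx⟩
  · rintro ⟨i, hi, j, hj, hix, hxj⟩
    exact exists_mem_consecutivePairs hi hj hix hxj

theorem card_hull : #(hull D) = ∑ p ∈ consecutivePairs D, #(Ioc p.1 p.2) := by
  refine card_biUnion fun p hp q hq hpq => disjoint_left.2 fun x hxp hxq => hpq ?_
  rw [mem_Ioc] at hxp hxq
  exact eq_of_mem_consecutivePairs hp hq hxp.1 hxp.2 hxq.1 hxq.2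

theorem hull_nonempty : (hull D).Nonempty ↔ D.Nontrivial := by
  constructor
  · rintro ⟨x, hx⟩
    obtain ⟨i, hi, j, hj, hix, hxj⟩ := mem_hull.1 hx
    exact ⟨i, hi, j, hj, (hix.trans_le hxj).ne⟩
  · rintro ⟨i, hi, j, hj, hij⟩
    rcases lt_or_gt_of_ne hij with h | h
    · exact ⟨j, mem_hull.2 ⟨i, hi, j, hj, h, le_rfl⟩⟩
    · exact ⟨i, mem_hull.2 ⟨j, hj, i, hi, h, le_rfl⟩⟩

end Hull

theorem exists_fin_family_iff {α : Type*} [DecidableEq α] {S : Set α} {f : α → ℕ} {R : Finset α}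
    (hRS : ↑R ⊆ S) (hR : ∀ a ∈ S, f a ≠ 0 → a ∈ R) {n : ℕ} :
    (∃ r : Fin n → α, (∀ i, r i ∈ S) ∧ ∀ a ∈ S, (Finset.univ.filter fun i => r i = a).card = f a) ↔
      ∑ a ∈ R, f a = n := by
  constructor
  · rintro ⟨r, hr, hcount⟩
    have hmaps : Set.MapsTo r (Finset.univ : Finset (Fin n)) R := fun i _ => by
      refine hR _ (hr i) ?_
      rw [← hcount _ (hr i)]
      exact Finset.card_ne_zero_of_mem (Finset.mem_filter.2 ⟨Finset.mem_univ i, rfl⟩)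
    rw [← Finset.sum_congr rfl fun a ha => hcount a (hRS ha), ← Finset.card_eq_sum_card_fiberwise
      hmaps, Finset.card_univ, Fintype.card_fin]
  · intro hsum
    let m : Multiset α := ∑ a ∈ R, Multiset.replicate (f a) a
    obtain rfl : n = m.toList.length := by simp [m, hsum]
    have hcount : ∀ a, m.count a = if a ∈ R then f a else 0 := fun a => by
      simp [m, Multiset.count_sum', Multiset.count_replicate]
    have hmap : Finset.univ.val.map m.toList.get = m := by
      rw [Fin.univ_val_map, List.ofFn_get, Multiset.coe_toList]
    refine ⟨m.toList.get, fun i => hRS ?_, fun a ha => ?_⟩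
    · have hi : m.toList.get i ∈ m := Multiset.mem_toList.1 (List.get_mem _ i)
      by_contra hiR
      rw [← Multiset.count_pos, hcount, if_neg (by simpa using hiR)] at hi
      exact hi.false
    · have hfa : m.count a = f a := by
        rw [hcount, ite_eq_left_iff]
        exact fun haR => (not_imp_comm.1 (hR a ha) haR).symm
      rw [← hfa, ← congrArg (Multiset.count a) hmap, Multiset.count_map]
      simp only [Finset.card_def, Finset.filter_val, eq_comm]

/-! ### Newton polygons over the tropical semifield -/

section Polynomial

open Polynomial

theorem card_hull_support_add_natTrailingDegree {R : Type*} [Semiring R] (P : R[X]) :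
    (hull P.support).card + P.natTrailingDegree = P.natDegree := by
  rcases eq_or_ne P 0 with rfl | hP
  · simp [hull, consecutivePairs]
  have hhull : hull P.support = Finset.Ioc P.natTrailingDegree P.natDegree := by
    ext l
    simp only [mem_hull, Finset.mem_Ioc]
    constructor
    · rintro ⟨i, hi, j, hj, hil, hlj⟩
      exact ⟨(natTrailingDegree_le_of_mem_supp i hi).trans_lt hil,
        hlj.trans (le_natDegree_of_mem_supp j hj)⟩
    · exact fun hl => ⟨_, natTrailingDegree_mem_support_of_nonzero hP, _,
        natDegree_mem_support_of_nonzero hP, hl⟩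
  rw [hhull, Nat.card_Ioc, Nat.sub_add_cancel P.natTrailingDegree_le_natDegree]

theorem successiveDegrees_iff {R : Type*} [Semiring R] {P : R[X]} {k l : ℕ} :
    SuccessiveDegrees P k l ↔ (k, l) ∈ consecutivePairs P.support := by
  simp only [SuccessiveDegrees, mem_consecutivePairs, mem_support_iff]
  grind

end Polynomial

section OrderedGroupWithZero

variable {G : Type*} [LinearOrderedCommGroupWithZero G] {u v c s : G} {m : ℕ}

theorem mul_pow_le_mul_pow_add_iff (hv : v ≠ 0) (hc : c ≠ 0) (hm : m ≠ 0) (hs : v * s ^ m = u)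
    (i : ℕ) : u * c ^ i ≤ v * c ^ (i + m) ↔ s ≤ c := by
  rw [← hs, pow_add, mul_right_comm, ← mul_assoc,
    mul_le_mul_iff_right₀ (zero_lt_iff.2 (mul_ne_zero hv (pow_ne_zero i hc))),
    pow_le_pow_iff_left₀ zero_le zero_le hm]

theorem mul_pow_add_le_mul_pow_iff (hv : v ≠ 0) (hc : c ≠ 0) (hm : m ≠ 0) (hs : v * s ^ m = u)
    (i : ℕ) : v * c ^ (i + m) ≤ u * c ^ i ↔ c ≤ s := by
  rw [← hs, pow_add, mul_right_comm v, ← mul_assoc,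
    mul_le_mul_iff_right₀ (zero_lt_iff.2 (mul_ne_zero hv (pow_ne_zero i hc))),
    pow_le_pow_iff_left₀ zero_le zero_le hm]

end OrderedGroupWithZero

namespace Tmax

open Finset Polynomial

variable {Γ : Type*} [AddCommGroup Γ] [LinearOrder Γ] [IsOrderedAddMonoid Γ]

theorem exists_pow_eq (hdiv : ∀ m : ℕ, 0 < m → ∀ a : Γ, ∃ b : Γ, m • b = a)
    {m : ℕ} (hm : 0 < m) {x : Tmax Γ} (hx : x ≠ 0) : ∃ y : Tmax Γ, y ^ m = x := by
  obtain ⟨a, rfl⟩ := WithZero.ne_zero_iff_exists.1 hx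
  obtain ⟨b, hb⟩ := hdiv m hm a.toAdd
  refine ⟨((Multiplicative.ofAdd b : Multiplicative Γ) : WithZero (Multiplicative Γ)), ?_⟩
  change ((Multiplicative.ofAdd b ^ m : Multiplicative Γ) : WithZero (Multiplicative Γ)) = a
  rw [← ofAdd_nsmul, hb, ofAdd_toAdd]

theorem exists_crossing (hdiv : ∀ m : ℕ, 0 < m → ∀ a : Γ, ∃ b : Γ, m • b = a)
    {u v : Tmax Γ} (hu : u ≠ 0) (hv : v ≠ 0) {i k : ℕ} (hik : i < k) :
    ∃ s ≠ 0, ∀ c ≠ 0, (u * c ^ i ≤ v * c ^ k ↔ s ≤ c) ∧ (v * c ^ k ≤ u * c ^ i ↔ c ≤ s) := by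
  obtain ⟨m, rfl⟩ := Nat.exists_eq_add_of_lt hik
  obtain ⟨s, hs⟩ := exists_pow_eq hdiv m.succ_pos (div_ne_zero hu hv)
  have hs' : v * s ^ (m + 1) = u := by rw [hs, mul_div_cancel₀ _ hv]
  exact ⟨s, ne_zero_pow m.succ_ne_zero (hs ▸ div_ne_zero hu hv), fun c hc =>
    ⟨mul_pow_le_mul_pow_add_iff hv hc m.succ_ne_zero hs' i,
      mul_pow_add_le_mul_pow_iff hv hc m.succ_ne_zero hs' i⟩⟩

theorem sum_eq_sup {κ : Type*} (s : Finset κ) (f : κ → Tmax Γ) : ∑ i ∈ s, f i = s.sup f := by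
  classical
  induction s using Finset.induction_on with
  | empty => rfl
  | insert i s hi ih => rw [sum_insert hi, sup_insert, ih, add_eq_max]

variable {Q : (Tmax Γ)[X]} {c d : Tmax Γ} {i j l : ℕ}

theorem eval_eq_sup : Q.eval c = Q.support.sup fun i => Q.coeff i * c ^ i := by
  rw [eval_eq_sum, Polynomial.sum, sum_eq_sup]

theorem coeff_mul_pow_le_eval : Q.coeff i * c ^ i ≤ Q.eval c := by
  by_cases hi : i ∈ Q.support
  · exact eval_eq_sup (Q := Q) ▸ le_sup (f := fun i => Q.coeff i * c ^ i) hi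
  · rw [notMem_support_iff.1 hi, zero_mul]
    exact zero_le

/-- The degrees of the monomials of `Q` that dominate at `c`, that is, whose value at `c` is
the value of `Q`. -/
def maximizers (Q : (Tmax Γ)[X]) (c : Tmax Γ) : Finset ℕ :=
  Q.support.filter fun i => Q.coeff i * c ^ i = Q.eval c

theorem mem_maximizers : i ∈ maximizers Q c ↔ Q.coeff i ≠ 0 ∧ Q.coeff i * c ^ i = Q.eval c := by
  simp [maximizers]

theorem maximizers_nonempty (hQ : Q ≠ 0) (c : Tmax Γ) : (maximizers Q c).Nonempty := by
  obtain ⟨i, hi, h⟩ := exists_mem_eq_sup _ (support_nonempty.2 hQ) fun i => Q.coeff i * c ^ i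
  exact ⟨i, mem_filter.2 ⟨hi, by rw [eval_eq_sup, h]⟩⟩

theorem mem_maximizers_iff_forall_le :
    i ∈ maximizers Q c ↔ Q.coeff i ≠ 0 ∧ ∀ j, Q.coeff j * c ^ j ≤ Q.coeff i * c ^ i := by
  refine mem_maximizers.trans (and_congr_right fun _ => ⟨fun h j => ?_, fun h => ?_⟩)
  · exact h ▸ coeff_mul_pow_le_eval
  · exact coeff_mul_pow_le_eval.antisymm (eval_eq_sup.trans_le (Finset.sup_le fun j _ => h j))

theorem isCorner_iff_maximizers_nontrivial (hc : c ≠ 0) :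
    IsCorner Q c ↔ (maximizers Q c).Nontrivial := by
  simp only [IsCorner, hc, ne_eq, not_false_eq_true, true_and, false_and, or_false,
    Finset.Nontrivial, Set.Nontrivial, mem_coe, maximizers, mem_filter]
  grind

theorem le_of_mem_maximizers (hc : c ≠ 0) (hcd : c < d) (hi : i ∈ maximizers Q c)
    (hj : j ∈ maximizers Q d) : i ≤ j := by
  rw [mem_maximizers_iff_forall_le] at hi hj
  by_contra! hji
  refine (hj.2 i).not_gt ?_
  have hd : d = c * (d / c) := (mul_div_cancel₀ d hc).symm
  have hone : 1 < d / c := (one_lt_div₀ (zero_lt_iff.2 hc)).2 hcd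
  calc Q.coeff j * d ^ j = Q.coeff j * c ^ j * (d / c) ^ j := by rw [mul_assoc, ← mul_pow, ← hd]
    _ < Q.coeff j * c ^ j * (d / c) ^ i := by
      gcongr
      exact zero_lt_iff.2 (mul_ne_zero hj.1 (pow_ne_zero j hc))
    _ ≤ Q.coeff i * c ^ i * (d / c) ^ i := by gcongr ?_ * _; exact hi.2 j
    _ = Q.coeff i * d ^ i := by rw [mul_assoc, ← mul_pow, ← hd]

theorem eq_of_mem_hull_maximizers (hc : c ≠ 0) (hd : d ≠ 0) (hlc : l ∈ hull (maximizers Q c))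
    (hld : l ∈ hull (maximizers Q d)) : c = d := by
  obtain ⟨i, hi, j, hj, hil, hlj⟩ := mem_hull.1 hlc
  obtain ⟨i', hi', j', hj', hil', hlj'⟩ := mem_hull.1 hld
  by_contra hcd
  rcases lt_or_gt_of_ne hcd with h | h
  · have := le_of_mem_maximizers hc h hj hi'
    lia
  · have := le_of_mem_maximizers hd h hj' hi
    lia

theorem exists_mem_hull_maximizers (hdiv : ∀ m : ℕ, 0 < m → ∀ a : Γ, ∃ b : Γ, m • b = a)
    (hl : l ∈ hull Q.support) : ∃ c ≠ 0, l ∈ hull (maximizers Q c) := by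
  obtain ⟨a, ha, b, hb, hal, hlb⟩ := mem_hull.1 hl
  choose! s hs_ne hs using fun i k (hi : i < l) (hk : l ≤ k) (hQi : Q.coeff i ≠ 0)
    (hQk : Q.coeff k ≠ 0) => exists_crossing hdiv hQi hQk (hi.trans_le hk)
  -- At the max-min of the crossing points a degree below `l` ties with one above.
  choose κ hκ hκ_min using fun i =>
    exists_min_image (Q.support.filter (l ≤ ·)) (s i) ⟨b, mem_filter.2 ⟨hb, hlb⟩⟩
  obtain ⟨i, hi, hi_max⟩ := exists_max_image (Q.support.filter (· < l)) (fun i => s i (κ i))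
    ⟨a, mem_filter.2 ⟨ha, hal⟩⟩
  simp only [mem_filter, mem_support_iff, and_imp] at hκ hκ_min hi hi_max
  set c := s i (κ i)
  have hc : c ≠ 0 := hs_ne i (κ i) hi.2 (hκ i).2 hi.1 (hκ i).1
  have hi_ge : ∀ k, l ≤ k → Q.coeff k ≠ 0 → Q.coeff k * c ^ k ≤ Q.coeff i * c ^ i :=
    fun k hk hQk => ((hs i k hi.2 hk hi.1 hQk c hc).2).2 (hκ_min i k hQk hk)
  have hκ_ge : ∀ k, k < l → Q.coeff k ≠ 0 → Q.coeff k * c ^ k ≤ Q.coeff (κ k) * c ^ κ k :=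
    fun k hk hQk => ((hs k _ hk (hκ k).2 hQk (hκ k).1 c hc).1).2 (hi_max k hQk hk)
  have hi_mem : i ∈ maximizers Q c := by
    refine mem_maximizers_iff_forall_le.2 ⟨hi.1, fun k => ?_⟩
    rcases eq_or_ne (Q.coeff k) 0 with hQk | hQk
    · rw [hQk, zero_mul]
      exact zero_le
    rcases lt_or_ge k l with hk | hk
    · exact (hκ_ge k hk hQk).trans (hi_ge _ (hκ k).2 (hκ k).1)
    · exact hi_ge k hk hQk
  have hκ_mem : κ i ∈ maximizers Q c := mem_maximizers_iff_forall_le.2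
    ⟨(hκ i).1, fun k => ((mem_maximizers_iff_forall_le.1 hi_mem).2 k).trans (hκ_ge i hi.2 hi.1)⟩
  exact ⟨c, hc, mem_hull.2 ⟨i, hi_mem, κ i, hκ_mem, hi.2, (hκ i).2⟩⟩

/-- The non-zero corners of `Q`. -/
def nonzeroCorners (Q : (Tmax Γ)[X]) : Set (Tmax Γ) := {c | c ≠ 0 ∧ IsCorner Q c}

theorem mem_nonzeroCorners : c ∈ nonzeroCorners Q ↔ c ≠ 0 ∧ (hull (maximizers Q c)).Nonempty := by
  rw [hull_nonempty]
  exact and_congr_right isCorner_iff_maximizers_nontrivial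

theorem hull_maximizers_subset : hull (maximizers Q c) ⊆ hull Q.support := fun l hl => by
  obtain ⟨i, hi, j, hj, h⟩ := mem_hull.1 hl
  exact mem_hull.2 ⟨i, mem_of_mem_filter i hi, j, mem_of_mem_filter j hj, h⟩

theorem finite_nonzeroCorners (Q : (Tmax Γ)[X]) : (nonzeroCorners Q).Finite := by
  choose! l hl using fun c (hc : c ∈ nonzeroCorners Q) => (mem_nonzeroCorners.1 hc).2
  refine Set.Finite.of_injOn (f := l) (fun c hc => mem_coe.2 (hull_maximizers_subset (hl c hc)))
    (fun c hc d hd hcd => ?_) (hull Q.support).finite_toSet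
  exact eq_of_mem_hull_maximizers hc.1 hd.1 (hl c hc) (hcd ▸ hl d hd)

theorem sum_card_hull_maximizers (hdiv : ∀ m : ℕ, 0 < m → ∀ a : Γ, ∃ b : Γ, m • b = a)
    (Q : (Tmax Γ)[X]) :
    ∑ c ∈ (finite_nonzeroCorners Q).toFinset, #(hull (maximizers Q c)) = #(hull Q.support) := by
  classical
  rw [← card_biUnion]
  · congr 1
    ext l
    simp only [mem_biUnion, Set.Finite.mem_toFinset]
    refine ⟨fun ⟨c, _, hl⟩ => hull_maximizers_subset hl, fun hl => ?_⟩
    obtain ⟨c, hc, hlc⟩ := exists_mem_hull_maximizers hdiv hl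
    exact ⟨c, mem_nonzeroCorners.2 ⟨hc, l, hlc⟩, hlc⟩
  · intro c hc d hd hcd
    rw [mem_coe, Set.Finite.mem_toFinset] at hc hd
    exact disjoint_left.2 fun l hlc hld => hcd (eq_of_mem_hull_maximizers hc.1 hd.1 hlc hld)

end Tmax

/-! ### Arithmetic of the symmetrized semiring -/

namespace Smax

open Polynomial

variable {Γ : Type*} [AddCommGroup Γ] [LinearOrder Γ] [IsOrderedAddMonoid Γ]

section Arithmetic

theorem exists_eq_mk (x : Smax Γ) : ∃ a b, x = mk a b := by
  obtain ⟨⟨a, b⟩, rfl⟩ := (TmaxPair.con Γ).mk'_surjective x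
  exact ⟨a, b, rfl⟩

theorem mk_eq_mk {a b c d : Tmax Γ} : mk a b = mk c d ↔
    (b < a ∧ d < c ∧ a = c) ∨ (a < b ∧ c < d ∧ b = d) ∨ (a = c ∧ b = d) := by
  change ((⟨a, b⟩ : TmaxPair Γ) : (TmaxPair.con Γ).Quotient) = (⟨c, d⟩ : TmaxPair Γ) ↔ _
  rw [RingCon.eq]
  change TmaxPair.Rel _ _ ↔ _
  rw [TmaxPair.rel_iff]
  simp

theorem zero_eq_mk : (0 : Smax Γ) = mk 0 0 := rfl

theorem mk_add_mk (a b c d : Tmax Γ) : mk a b + mk c d = mk (a + c) (b + d) := rfl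

theorem mk_mul_mk (a b c d : Tmax Γ) : mk a b * mk c d = mk (a * c + b * d) (a * d + b * c) := rfl

theorem abs_mk (a b : Tmax Γ) : abs (mk a b) = max a b := rfl

theorem balance_mk {a b c d : Tmax Γ} : Balance (mk a b) (mk c d) ↔ a + d = b + c := Iff.rfl

instance : HasDistribNeg (Smax Γ) where
  neg := neg
  neg_neg x := by
    obtain ⟨a, b, rfl⟩ := exists_eq_mk x
    rfl
  neg_mul x y := by
    obtain ⟨a, b, rfl⟩ := exists_eq_mk x
    obtain ⟨c, d, rfl⟩ := exists_eq_mk y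
    change mk (b * c + a * d) (b * d + a * c) = mk (a * d + b * c) (a * c + b * d)
    rw [add_comm (b * c), add_comm (b * d)]
  mul_neg x y := by
    obtain ⟨a, b, rfl⟩ := exists_eq_mk x
    obtain ⟨c, d, rfl⟩ := exists_eq_mk y
    rfl

theorem neg_eq_neg (x : Smax Γ) : neg x = -x := rfl

theorem neg_mk (a b : Tmax Γ) : -mk a b = mk b a := rfl

variable {x y : Smax Γ}

@[simp] theorem abs_neg (x : Smax Γ) : abs (-x) = abs x := by
  obtain ⟨a, b, rfl⟩ := exists_eq_mk x
  exact max_comm b a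

@[simp] theorem abs_ofTmax (c : Tmax Γ) : abs (ofTmax c) = c := max_eq_left zero_le

@[simp] theorem abs_eq_zero : abs x = 0 ↔ x = 0 := by
  obtain ⟨a, b, rfl⟩ := exists_eq_mk x
  rw [abs_mk, zero_eq_mk, mk_eq_mk]
  have := zero_le (a := a)
  have := zero_le (a := b)
  grind

theorem abs_ne_zero : abs x ≠ 0 ↔ x ≠ 0 := abs_eq_zero.not

theorem neg_ne_zero (hx : x ≠ 0) : -x ≠ 0 := abs_ne_zero.1 (abs_neg x ▸ abs_ne_zero.2 hx)

theorem ofTmax_ne_zero {c : Tmax Γ} (hc : c ≠ 0) : ofTmax c ≠ 0 := abs_ne_zero.1 (by simpa)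

theorem abs_add (x y : Smax Γ) : abs (x + y) = max (abs x) (abs y) := map_add abs x y

instance : Nontrivial (Smax Γ) := abs.domain_nontrivial

instance : NoZeroDivisors (Smax Γ) where
  eq_zero_or_eq_zero_of_mul_eq_zero h := by
    rw [← abs_eq_zero, map_mul, mul_eq_zero] at h
    exact h.imp abs_eq_zero.1 abs_eq_zero.1

theorem exists_eq_mk_of_mem_signed (hx : x ∈ signed Γ) : ∃ c, x = mk c 0 ∨ x = mk 0 c := by
  rcases hx with ⟨c, rfl⟩ | ⟨c, rfl⟩
  · exact ⟨c, Or.inl rfl⟩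
  · exact ⟨c, Or.inr rfl⟩

theorem ofTmax_mem_signed (c : Tmax Γ) : ofTmax c ∈ signed Γ := Or.inl ⟨c, rfl⟩

theorem zero_mem_signed : (0 : Smax Γ) ∈ signed Γ := ofTmax_mem_signed 0

theorem one_mem_signed : (1 : Smax Γ) ∈ signed Γ := ofTmax_mem_signed 1

theorem neg_mem_signed (hx : x ∈ signed Γ) : -x ∈ signed Γ := by
  obtain ⟨c, rfl | rfl⟩ := exists_eq_mk_of_mem_signed hx
  · exact Or.inr ⟨c, rfl⟩
  · exact Or.inl ⟨c, rfl⟩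

theorem eq_ofTmax_abs_or_eq_neg (hx : x ∈ signed Γ) :
    x = ofTmax (abs x) ∨ x = -ofTmax (abs x) := by
  obtain ⟨c, rfl | rfl⟩ := exists_eq_mk_of_mem_signed hx
  · exact Or.inl (by rw [abs_mk, max_eq_left zero_le]; rfl)
  · exact Or.inr (by rw [abs_mk, max_eq_right zero_le]; rfl)

theorem ofTmax_one : ofTmax (1 : Tmax Γ) = 1 := rfl

theorem ofTmax_mul (c d : Tmax Γ) : ofTmax (c * d) = ofTmax c * ofTmax d := by
  simp [ofTmax, mk_mul_mk]

theorem ofTmax_pow (c : Tmax Γ) (k : ℕ) : ofTmax (c ^ k) = ofTmax c ^ k := by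
  induction k with
  | zero => rw [pow_zero, pow_zero, ofTmax_one]
  | succ k ih => rw [pow_succ, pow_succ, ofTmax_mul, ih]

theorem mul_mem_signed (hx : x ∈ signed Γ) (hy : y ∈ signed Γ) : x * y ∈ signed Γ := by
  rcases eq_ofTmax_abs_or_eq_neg hx with hx | hx <;>
    rcases eq_ofTmax_abs_or_eq_neg hy with hy | hy <;> rw [hx, hy]
  all_goals simp only [neg_mul, mul_neg, neg_neg, ← ofTmax_mul]
  all_goals first | exact ofTmax_mem_signed _ | exact neg_mem_signed (ofTmax_mem_signed _)

theorem pow_mem_signed (hx : x ∈ signed Γ) (k : ℕ) : x ^ k ∈ signed Γ := by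
  induction k with
  | zero => exact pow_zero x ▸ one_mem_signed
  | succ k ih => exact pow_succ x k ▸ mul_mem_signed ih hx

theorem exists_mul_eq_one (hx : x ∈ signed Γ) (hx₀ : x ≠ 0) :
    ∃ y ∈ signed Γ, y ≠ 0 ∧ x * y = 1 := by
  have hinv : ofTmax (abs x) * ofTmax (abs x)⁻¹ = 1 := by
    rw [← ofTmax_mul, mul_inv_cancel₀ (abs_ne_zero.2 hx₀), ofTmax_one]
  have hne : ofTmax (abs x)⁻¹ ≠ 0 := right_ne_zero_of_mul_eq_one hinv
  rcases eq_ofTmax_abs_or_eq_neg hx with hx | hx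
  · exact ⟨_, ofTmax_mem_signed _, hne, by rwa [← hx] at hinv⟩
  · exact ⟨_, neg_mem_signed (ofTmax_mem_signed _), neg_ne_zero hne,
      by rwa [← neg_mul_neg, ← hx] at hinv⟩

theorem eq_or_eq_neg_of_abs_eq (hx : x ∈ signed Γ) (hy : y ∈ signed Γ) (h : abs x = abs y) :
    x = y ∨ x = -y := by
  rcases eq_ofTmax_abs_or_eq_neg hx with hx | hx <;>
    rcases eq_ofTmax_abs_or_eq_neg hy with hy | hy <;> rw [hx, hy, h] <;> simp

theorem balance_refl (x : Smax Γ) : Balance x x := by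
  obtain ⟨a, b, rfl⟩ := exists_eq_mk x
  exact balance_mk.2 (add_comm a b)

theorem eq_of_balance (hx : x ∈ signed Γ) (hy : y ∈ signed Γ) (h : Balance x y) : x = y := by
  obtain ⟨c, rfl | rfl⟩ := exists_eq_mk_of_mem_signed hx <;>
    obtain ⟨d, rfl | rfl⟩ := exists_eq_mk_of_mem_signed hy <;>
    · rw [balance_mk, Tmax.add_eq_max, Tmax.add_eq_max] at h
      rw [mk_eq_mk]
      have := zero_le (a := c)
      have := zero_le (a := d)
      grind

theorem ne_neg_self (hx : x ∈ signed Γ) (hx₀ : x ≠ 0) : x ≠ -x := fun h => by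
  refine hx₀ (eq_of_balance hx zero_mem_signed ?_)
  obtain ⟨a, b, rfl⟩ := exists_eq_mk x
  rw [neg_mk, mk_eq_mk] at h
  rw [zero_eq_mk, balance_mk, add_zero, add_zero]
  grind

theorem mul_self_eq_ofTmax (hx : x ∈ signed Γ) : x * x = ofTmax (abs x * abs x) := by
  rw [ofTmax_mul]
  rcases eq_ofTmax_abs_or_eq_neg hx with h | h
  · rw [← h]
  · rw [← neg_mul_neg (ofTmax (abs x)), ← h]

theorem ofTmax_notMem_nonpos {c : Tmax Γ} (hc : c ≠ 0) : ofTmax c ∉ nonpos Γ := by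
  rintro ⟨d, hd⟩
  have hcd : c = d := by simpa [abs_mk] using congrArg abs hd
  subst hcd
  exact ne_neg_self (ofTmax_mem_signed c) (ofTmax_ne_zero hc) hd

theorem eq_neg_iff_mul_mem_nonpos (hx : x ∈ signed Γ) (hy : y ∈ signed Γ) (hx₀ : x ≠ 0)
    (h : abs x = abs y) : x = -y ↔ x * y ∈ nonpos Γ := by
  rcases eq_or_eq_neg_of_abs_eq hx hy h with rfl | rfl
  · refine iff_of_false (ne_neg_self hx hx₀) (mul_self_eq_ofTmax hx ▸ ofTmax_notMem_nonpos ?_)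
    exact mul_ne_zero (abs_ne_zero.2 hx₀) (abs_ne_zero.2 hx₀)
  · refine iff_of_true rfl ⟨abs y * abs y, ?_⟩
    rw [neg_mul, mul_self_eq_ofTmax hy]
    rfl

theorem mul_ofTmax_mem_nonpos {c : Tmax Γ} (hx : x ∈ nonpos Γ) : x * ofTmax c ∈ nonpos Γ := by
  obtain ⟨d, rfl⟩ := hx
  exact ⟨d * c, by simp [ofTmax, mk_mul_mk]⟩

theorem mul_ofTmax_mem_nonpos_iff {c : Tmax Γ} (hc : c ≠ 0) :
    x * ofTmax c ∈ nonpos Γ ↔ x ∈ nonpos Γ := by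
  refine ⟨fun h => ?_, mul_ofTmax_mem_nonpos⟩
  simpa only [mul_assoc, ← ofTmax_mul, mul_inv_cancel₀ hc, ofTmax_one, mul_one]
    using mul_ofTmax_mem_nonpos (c := c⁻¹) h

theorem add_eq_left_of_abs_le (hx : x ∈ signed Γ) (hy : y ∈ signed Γ) (h : abs y ≤ abs x)
    (hne : y ≠ -x) : x + y = x := by
  obtain ⟨c, rfl | rfl⟩ := exists_eq_mk_of_mem_signed hx <;>
    obtain ⟨d, rfl | rfl⟩ := exists_eq_mk_of_mem_signed hy <;>
    · have := zero_le (a := c)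
      have := zero_le (a := d)
      simp only [ne_eq, neg_mk, mk_add_mk, Tmax.add_eq_max, abs_mk, mk_eq_mk] at *
      grind

theorem abs_le_of_balance (hx : x ∈ signed Γ) (h : Balance x y) : abs x ≤ abs y := by
  obtain ⟨a, b, rfl⟩ := exists_eq_mk y
  obtain ⟨c, rfl | rfl⟩ := exists_eq_mk_of_mem_signed hx <;>
    · have := zero_le (a := a)
      have := zero_le (a := b)
      simp only [balance_mk, Tmax.add_eq_max, abs_mk] at *
      grind

theorem balance_add_of_abs_le (h : abs y ≤ abs x) : Balance x (x + y) := by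
  obtain ⟨a, b, rfl⟩ := exists_eq_mk x
  obtain ⟨c, d, rfl⟩ := exists_eq_mk y
  simp only [mk_add_mk, balance_mk, Tmax.add_eq_max, abs_mk] at *
  grind

theorem balance_add_neg_of_abs_le (h : abs x ≤ abs y) : Balance x (y + -y) := by
  obtain ⟨a, b, rfl⟩ := exists_eq_mk x
  obtain ⟨c, d, rfl⟩ := exists_eq_mk y
  simp only [neg_mk, mk_add_mk, balance_mk, Tmax.add_eq_max, abs_mk] at *
  grind

theorem add_neg_add_balance_zero (h : abs y ≤ abs x) : Balance (x + (-x + y)) 0 := by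
  obtain ⟨a, b, rfl⟩ := exists_eq_mk x
  obtain ⟨c, d, rfl⟩ := exists_eq_mk y
  simp only [neg_mk, mk_add_mk, zero_eq_mk, balance_mk, Tmax.add_eq_max, abs_mk] at *
  grind

theorem balance_mul_left (t : Smax Γ) (h : Balance x y) : Balance (t * x) (t * y) := by
  obtain ⟨a, b, rfl⟩ := exists_eq_mk x
  obtain ⟨c, d, rfl⟩ := exists_eq_mk y
  obtain ⟨e, f, rfl⟩ := exists_eq_mk t
  rw [mk_mul_mk, mk_mul_mk, balance_mk]
  rw [balance_mk] at h
  calc e * a + f * b + (e * d + f * c) = e * (a + d) + f * (b + c) := by ring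
    _ = e * (b + c) + f * (a + d) := by rw [h]
    _ = e * b + f * a + (e * c + f * d) := by ring

section Sum

variable {κ : Type*} {s : Finset κ} {f : κ → Smax Γ} {i : κ}

theorem abs_sum (s : Finset κ) (f : κ → Smax Γ) :
    abs (∑ j ∈ s, f j) = s.sup fun j => abs (f j) := by
  rw [map_sum, Tmax.sum_eq_sup]

theorem add_sum_eq_left (hx : x ∈ signed Γ) (hf : ∀ j ∈ s, f j ∈ signed Γ)
    (hle : ∀ j ∈ s, abs (f j) ≤ abs x) (hne : ∀ j ∈ s, f j ≠ -x) : x + ∑ j ∈ s, f j = x := by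
  induction s using Finset.cons_induction with
  | empty => exact add_zero x
  | cons j s _ ih =>
    simp only [Finset.mem_cons, forall_eq_or_imp] at hf hle hne
    rw [Finset.sum_cons, ← add_assoc, add_eq_left_of_abs_le hx hf.1 hle.1 hne.1,
      ih hf.2 hle.2 hne.2]

theorem sum_balance_zero_iff (hf : ∀ j ∈ s, f j ∈ signed Γ) (hi : i ∈ s) (hfi : f i ≠ 0)
    (hle : ∀ j ∈ s, abs (f j) ≤ abs (f i)) :
    Balance (∑ j ∈ s, f j) 0 ↔ ∃ j ∈ s, f j = -f i := by
  classical
  rw [← Finset.add_sum_erase s f hi]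
  constructor
  · contrapose!
    intro hne hbal
    rw [add_sum_eq_left (hf i hi) (fun j hj => hf j (Finset.mem_of_mem_erase hj))
      (fun j hj => hle j (Finset.mem_of_mem_erase hj))
      (fun j hj => hne j (Finset.mem_of_mem_erase hj))] at hbal
    exact hfi (eq_of_balance (hf i hi) zero_mem_signed hbal)
  · rintro ⟨j, hj, hji⟩
    have hij : j ≠ i := by
      rintro rfl
      exact ne_neg_self (hf j hj) hfi hji
    rw [← Finset.add_sum_erase (s.erase i) f (Finset.mem_erase.2 ⟨hij, hj⟩), hji]
    refine add_neg_add_balance_zero ((abs_sum _ _).trans_le (Finset.sup_le fun k hk => hle k ?_))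
    exact Finset.mem_of_mem_erase (Finset.mem_of_mem_erase hk)

end Sum

end Arithmetic

/-! ### Sign changes among the dominant monomials -/

section SignChanges

variable {P : (Smax Γ)[X]} {a t : Smax Γ} {i j : ℕ}

theorem eval_absPoly (a : Smax Γ) (P : (Smax Γ)[X]) :
    (absPoly P).eval (abs a) = abs (P.eval a) :=
  eval_map_apply abs a

theorem coeff_absPoly (P : (Smax Γ)[X]) (k : ℕ) : (absPoly P).coeff k = abs (P.coeff k) := by
  rw [absPoly, coeff_map]

theorem support_absPoly (P : (Smax Γ)[X]) : (absPoly P).support = P.support := by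
  ext k
  simp [coeff_absPoly]

theorem absPoly_ne_zero (hP : P ≠ 0) : absPoly P ≠ 0 := by
  rwa [← support_nonempty, support_absPoly, support_nonempty]

theorem abs_coeff_mul_pow_le_abs_eval (a : Smax Γ) (P : (Smax Γ)[X]) (i : ℕ) :
    abs (P.coeff i) * abs a ^ i ≤ abs (P.eval a) :=
  eval_absPoly a P ▸ coeff_absPoly P i ▸ Tmax.coeff_mul_pow_le_eval

theorem abs_eval_ne_zero (hP : P ≠ 0) (ha : a ≠ 0) : abs (P.eval a) ≠ 0 := by
  have hlead : abs P.leadingCoeff * abs a ^ P.natDegree ≠ 0 := by simp [hP, ha]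
  exact ((zero_lt_iff.2 hlead).trans_le (abs_coeff_mul_pow_le_abs_eval a P _)).ne'

theorem sat_eq_maximizers (hP : P ≠ 0) (ha : a ≠ 0) :
    sat a P = Tmax.maximizers (absPoly P) (abs a) := by
  ext i
  simp only [sat, Finset.mem_filter, Finset.mem_range, Tmax.mem_maximizers, eval_absPoly,
    coeff_absPoly, ne_eq, abs_eq_zero, eq_comm (b := abs (P.eval a))]
  refine and_congr_left fun h => ⟨fun _ hi => abs_eval_ne_zero hP ha ?_, fun hi => ?_⟩
  · rw [h, hi, map_zero, zero_mul]
  · exact Nat.lt_succ_of_le (le_natDegree_of_ne_zero hi)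

theorem mem_sat (hP : P ≠ 0) (ha : a ≠ 0) : i ∈ sat a P ↔
    P.coeff i ≠ 0 ∧ ∀ j, abs (P.coeff j * a ^ j) ≤ abs (P.coeff i * a ^ i) := by
  simp only [sat_eq_maximizers hP ha, Tmax.mem_maximizers_iff_forall_le, coeff_absPoly, ne_eq,
    abs_eq_zero, map_mul, map_pow]

theorem sat_nonempty (hP : P ≠ 0) (ha : a ≠ 0) : (sat a P).Nonempty :=
  sat_eq_maximizers hP ha ▸ Tmax.maximizers_nonempty (absPoly_ne_zero hP) _

theorem abs_eq_of_mem_sat (hi : i ∈ sat a P) (hj : j ∈ sat a P) :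
    abs (P.coeff i * a ^ i) = abs (P.coeff j * a ^ j) := by
  simp only [sat, Finset.mem_filter] at hi hj
  rw [map_mul, map_pow, map_mul, map_pow, ← hi.2, ← hj.2]

theorem mem_sat_of_abs_eq (hP : P ≠ 0) (ha : a ≠ 0) (hi : i ∈ sat a P)
    (h : abs (P.coeff j * a ^ j) = abs (P.coeff i * a ^ i)) : j ∈ sat a P := by
  rw [mem_sat hP ha] at hi ⊢
  refine ⟨fun hj => ?_, fun k => h ▸ hi.2 k⟩
  rw [hj, zero_mul, map_zero, eq_comm, abs_eq_zero] at h
  exact mul_ne_zero hi.1 (pow_ne_zero i ha) h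

theorem mul_pow_mem_signed (hP : IsSignedPoly P) (ha : a ∈ signed Γ) (k : ℕ) :
    P.coeff k * a ^ k ∈ signed Γ :=
  mul_mem_signed (hP k) (pow_mem_signed ha k)

theorem eq_or_eq_neg_of_mem_sat (hP : IsSignedPoly P) (ha : a ∈ signed Γ) (hi : i ∈ sat a P)
    (hj : j ∈ sat a P) : P.coeff i * a ^ i = P.coeff j * a ^ j ∨
      P.coeff i * a ^ i = -(P.coeff j * a ^ j) :=
  eq_or_eq_neg_of_abs_eq (mul_pow_mem_signed hP ha i) (mul_pow_mem_signed hP ha j)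
    (abs_eq_of_mem_sat hi hj)

/-- The pairs of successive degrees `k < l` of the dominant monomials of `P` at `a` at which
the sign of `Pₖ aᵏ` changes. Their number is the multiplicity of a non-zero `a`. -/
noncomputable def signChanges (a : Smax Γ) (P : (Smax Γ)[X]) : Finset (ℕ × ℕ) :=
  jumps (sat a P) fun k => P.coeff k * a ^ k

theorem isRootOf_iff_signChanges_nonempty (hP : IsSignedPoly P) (hP₀ : P ≠ 0)
    (ha : a ∈ signed Γ) (ha₀ : a ≠ 0) : IsRootOf a P ↔ (signChanges a P).Nonempty := by
  have hroot : ∀ i ∈ sat a P, (IsRootOf a P ↔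
      ∃ j ∈ P.support, P.coeff j * a ^ j = -(P.coeff i * a ^ i)) := fun i hi => by
    have hi := (mem_sat hP₀ ha₀).1 hi
    rw [IsRootOf, eval_eq_sum, Polynomial.sum]
    exact sum_balance_zero_iff (fun j _ => mul_pow_mem_signed hP ha j) (mem_support_iff.2 hi.1)
      (mul_ne_zero hi.1 (pow_ne_zero i ha₀)) fun j _ => hi.2 j
  have hne : ∀ i ∈ sat a P, P.coeff i * a ^ i ≠ -(P.coeff i * a ^ i) := fun i hi =>
    ne_neg_self (mul_pow_mem_signed hP ha i)
      (mul_ne_zero ((mem_sat hP₀ ha₀).1 hi).1 (pow_ne_zero i ha₀))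
  constructor
  · intro h
    obtain ⟨i, hi⟩ := sat_nonempty hP₀ ha₀
    obtain ⟨j, -, hji⟩ := (hroot i hi).1 h
    have hj : j ∈ sat a P := mem_sat_of_abs_eq hP₀ ha₀ hi (by rw [hji, abs_neg])
    rcases lt_trichotomy i j with hij | rfl | hij
    · obtain ⟨p, hp, -⟩ := exists_jump hi hj hij (f := fun k => P.coeff k * a ^ k)
        (hji ▸ hne i hi)
      exact ⟨p, hp⟩
    · exact absurd hji (hne i hi)
    · obtain ⟨p, hp, -⟩ := exists_jump hj hi hij (f := fun k => P.coeff k * a ^ k)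
        (hji ▸ (hne i hi).symm)
      exact ⟨p, hp⟩
  · rintro ⟨p, hp⟩
    obtain ⟨hp, hjump⟩ := mem_jumps.1 hp
    obtain ⟨hp₁, hp₂, -⟩ := mem_consecutivePairs.1 hp
    refine (hroot _ hp₂).2 ⟨p.1, mem_support_iff.2 ((mem_sat hP₀ ha₀).1 hp₁).1, ?_⟩
    exact (eq_or_eq_neg_of_mem_sat hP ha hp₁ hp₂).resolve_left hjump

theorem IsSignedPoly.C_mul (ht : t ∈ signed Γ) (hP : IsSignedPoly P) : IsSignedPoly (C t * P) :=
  fun k => by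
    rw [coeff_C_mul]
    exact mul_mem_signed ht (hP k)

theorem IsSignedPoly.comp_C_mul_X (ha : a ∈ signed Γ) (hP : IsSignedPoly P) :
    IsSignedPoly (P.comp (C a * X)) := fun k => by
  rw [comp_C_mul_X_coeff]
  exact mul_pow_mem_signed hP ha k

theorem sat_comp_C_mul_X (ha : a ≠ 0) (P : (Smax Γ)[X]) : sat 1 (P.comp (C a * X)) = sat a P := by
  simp only [sat, natDegree_comp, natDegree_C_mul_X a ha, mul_one, eval_comp, eval_mul, eval_C,
    eval_X, comp_C_mul_X_coeff, map_mul, map_pow, map_one, one_pow]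

theorem signChanges_comp_C_mul_X (ha : a ≠ 0) (P : (Smax Γ)[X]) :
    signChanges 1 (P.comp (C a * X)) = signChanges a P := by
  simp only [signChanges, sat_comp_C_mul_X ha, comp_C_mul_X_coeff, one_pow, mul_one]

theorem sat_C_mul (ht : t ≠ 0) (a : Smax Γ) (P : (Smax Γ)[X]) : sat a (C t * P) = sat a P := by
  simp only [sat, natDegree_C_mul ht, eval_mul, eval_C, coeff_C_mul, map_mul, mul_assoc,
    mul_right_inj' (abs_ne_zero.2 ht)]

theorem signChanges_C_mul (ht : t ∈ signed Γ) (ht₀ : t ≠ 0) (a : Smax Γ) (P : (Smax Γ)[X]) :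
    signChanges a (C t * P) = signChanges a P := by
  obtain ⟨s, -, -, hts⟩ := exists_mul_eq_one ht ht₀
  have hinj : ∀ x y : Smax Γ, t * x = t * y → x = y := fun _ _ =>
    (IsUnit.of_mul_eq_one s hts).mul_left_cancel
  simp only [signChanges, sat_C_mul ht₀, coeff_C_mul, mul_assoc]
  exact jumps_comp (g := (t * ·)) fun _ _ _ _ => hinj _ _

end SignChanges

/-! ### Division by `Y ⊖ a` -/

section DivisionUpperBound

variable {F G : (Smax Γ)[X]} {i j l : ℕ}

theorem mem_sat_one (hF : F ≠ 0) :
    i ∈ sat 1 F ↔ F.coeff i ≠ 0 ∧ ∀ j, abs (F.coeff j) ≤ abs (F.coeff i) := by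
  simp only [mem_sat hF one_ne_zero, one_pow, mul_one]

theorem mem_sat_one_of_abs_eq (hF : F ≠ 0) (hi : i ∈ sat 1 F)
    (h : abs (F.coeff j) = abs (F.coeff i)) : j ∈ sat 1 F :=
  mem_sat_of_abs_eq hF one_ne_zero hi (by simpa only [one_pow, mul_one] using h)

theorem signChanges_one (F : (Smax Γ)[X]) : signChanges 1 F = jumps (sat 1 F) F.coeff := by
  simp only [signChanges, one_pow, mul_one]

theorem coeff_X_add_C_neg_one_mul (G : (Smax Γ)[X]) (k : ℕ) :
    ((X + C (-1)) * G).coeff k = (X * G).coeff k + -G.coeff k := by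
  rw [add_mul, coeff_add, coeff_C_mul, neg_one_mul]

section Quotient

variable (hF : IsSignedPoly F) (hG : IsSignedPoly G) (hG₀ : G ≠ 0)
  (h : PolyBalance F ((X + C (-1)) * G))

include hF hG hG₀ h

theorem coeff_eq_neg_of_mem_runStarts (hl : l ∈ runStarts (sat 1 G) G.coeff) :
    F.coeff l = -G.coeff l := by
  obtain ⟨hl, hstart⟩ := mem_runStarts.1 hl
  have hG_l := (mem_sat_one hG₀).1 hl
  have hbal := h l
  rw [coeff_X_add_C_neg_one_mul, add_comm] at hbal
  rcases l with _ | k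
  · rw [coeff_X_mul_zero, add_zero] at hbal
    exact eq_of_balance (hF 0) (neg_mem_signed (hG 0)) hbal
  · rw [coeff_X_mul, add_eq_left_of_abs_le (neg_mem_signed (hG _)) (hG k)] at hbal
    · exact eq_of_balance (hF _) (neg_mem_signed (hG _)) hbal
    · simpa only [abs_neg] using hG_l.2 k
    · rw [neg_neg]
      intro heq
      have hk : k ∈ sat 1 G := mem_sat_one_of_abs_eq hG₀ hl (congrArg abs heq)
      exact hstart (k, k + 1)
        (mem_consecutivePairs.2 ⟨hk, hl, k.lt_succ_self, fun i _ => by lia⟩) rfl heq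

theorem coeff_max'_add_one (hne : (sat 1 G).Nonempty) :
    F.coeff ((sat 1 G).max' hne + 1) = G.coeff ((sat 1 G).max' hne) := by
  set m := (sat 1 G).max' hne
  have hm : m ∈ sat 1 G := (sat 1 G).max'_mem hne
  have hbal := h (m + 1)
  rw [coeff_X_add_C_neg_one_mul, coeff_X_mul,
    add_eq_left_of_abs_le (hG m) (neg_mem_signed (hG _))] at hbal
  · exact eq_of_balance (hF _) (hG m) hbal
  · simpa only [abs_neg] using ((mem_sat_one hG₀).1 hm).2 (m + 1)
  · intro heq
    have hsucc : m + 1 ∈ sat 1 G := mem_sat_one_of_abs_eq hG₀ hm (congrArg abs (neg_injective heq))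
    exact ((sat 1 G).le_max' _ hsucc).not_gt m.lt_succ_self

omit hG hG₀ in
theorem abs_coeff_le_of_polyBalance {M : Tmax Γ} (hM : ∀ j, abs (G.coeff j) ≤ M) (k : ℕ) :
    abs (F.coeff k) ≤ M := by
  refine (abs_le_of_balance (hF k) (h k)).trans ?_
  rw [coeff_X_add_C_neg_one_mul, abs_add, abs_neg]
  refine max_le ?_ (hM k)
  cases k with
  | zero => exact coeff_X_mul_zero G ▸ map_zero (abs (Γ := Γ)) ▸ zero_le
  | succ k => exact coeff_X_mul G k ▸ hM k

theorem insert_runStarts_subset_sat (hne : (sat 1 G).Nonempty) :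
    insert ((sat 1 G).max' hne + 1) (runStarts (sat 1 G) G.coeff) ⊆ sat 1 F := by
  have hF_m := coeff_max'_add_one hF hG hG₀ h hne
  set m := (sat 1 G).max' hne
  have hm : m ∈ sat 1 G := (sat 1 G).max'_mem hne
  have hG_m := (mem_sat_one hG₀).1 hm
  have hF_ne : F.coeff (m + 1) ≠ 0 := hF_m ▸ hG_m.1
  have hF₀ : F ≠ 0 := fun hF₀ => hF_ne (hF₀ ▸ coeff_zero _)
  have hm_succ : m + 1 ∈ sat 1 F :=
    (mem_sat_one hF₀).2 ⟨hF_ne, hF_m ▸ abs_coeff_le_of_polyBalance hF h hG_m.2⟩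
  refine Finset.insert_subset hm_succ fun l hl => mem_sat_one_of_abs_eq hF₀ hm_succ ?_
  rw [hF_m, coeff_eq_neg_of_mem_runStarts hF hG hG₀ h hl, abs_neg]
  simpa only [one_pow, mul_one] using abs_eq_of_mem_sat (mem_runStarts.1 hl).1 hm

theorem consecutivePairs_insert_runStarts_subset_jumps (hne : (sat 1 G).Nonempty) :
    consecutivePairs (insert ((sat 1 G).max' hne + 1) (runStarts (sat 1 G) G.coeff)) ⊆
      jumps (insert ((sat 1 G).max' hne + 1) (runStarts (sat 1 G) G.coeff)) F.coeff := by
  have hF_m := coeff_max'_add_one hF hG hG₀ h hne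
  set m := (sat 1 G).max' hne
  set S := runStarts (sat 1 G) G.coeff
  have hm : m ∈ sat 1 G := (sat 1 G).max'_mem hne
  have hS_le : ∀ l ∈ S, l ≤ m := fun l hl => (sat 1 G).le_max' l (mem_runStarts.1 hl).1
  have hF_S : ∀ l ∈ S, F.coeff l = -G.coeff l := fun l =>
    coeff_eq_neg_of_mem_runStarts hF hG hG₀ h
  refine fun p hp => mem_jumps.2 ⟨hp, ?_⟩
  simp only [mem_consecutivePairs, Finset.forall_mem_insert] at hp
  obtain ⟨hp₁, hp₂, hlt, -, hp⟩ := hp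
  have hp₁ : p.1 ∈ S := by grind
  rcases Finset.mem_insert.1 hp₂ with hp₂ | hp₂
  · obtain ⟨a, ha, ham, hGa, ha_max⟩ := exists_runStart_le (f := G.coeff) hm
    have hap : a = p.1 := by grind
    rw [hp₂, hF_m, hF_S _ hp₁, ← hap, hGa]
    exact (ne_neg_self (hG m) ((mem_sat_one hG₀).1 hm).1).symm
  · rw [hF_S _ hp₁, hF_S _ hp₂, neg_injective.ne_iff]
    exact ne_of_mem_consecutivePairs_runStarts (mem_consecutivePairs.2 ⟨hp₁, hp₂, hlt, hp⟩)

-- Each maximal run of equal signs among the dominant coefficients of `G` is seen in `(Y ⊖ 1) G`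
-- at its first degree, with the opposite sign; the last run is seen again just after its end.
theorem card_signChanges_lt_of_polyBalance : (signChanges 1 G).card < (signChanges 1 F).card := by
  have hne := sat_nonempty hG₀ (one_ne_zero (α := Smax Γ))
  set m := (sat 1 G).max' hne
  set S := runStarts (sat 1 G) G.coeff
  have hm : m + 1 ∉ S := fun hS =>
    ((sat 1 G).le_max' _ (mem_runStarts.1 hS).1).not_gt m.lt_succ_self
  rw [signChanges_one, signChanges_one]
  calc (jumps (sat 1 G) G.coeff).card < S.card := card_jumps_lt_card_runStarts hne
    _ ≤ (consecutivePairs (insert (m + 1) S)).card := by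
      rw [← Nat.add_le_add_iff_right (n := 1), ← Finset.card_insert_of_notMem hm]
      exact card_le_card_consecutivePairs_add_one
    _ ≤ (jumps (insert (m + 1) S) F.coeff).card :=
      Finset.card_le_card (consecutivePairs_insert_runStarts_subset_jumps hF hG hG₀ h hne)
    _ ≤ (jumps (sat 1 F) F.coeff).card :=
      card_jumps_le_of_subset (insert_runStarts_subset_sat hF hG hG₀ h hne)

end Quotient

end DivisionUpperBound

section DivisionLowerBound

variable {F : (Smax Γ)[X]} {k l : ℕ} {f : ℕ → Smax Γ} {M : Tmax Γ}

section LastMax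

/-- The last term of maximal absolute value among `f 0, …, f (k - 1)`, and `0` for `k = 0`.
The opposites of these terms are the low coefficients of a quotient of `⨁ᵢ f i Yⁱ` by `Y ⊖ 1`. -/
noncomputable def lastMax (f : ℕ → Smax Γ) : ℕ → Smax Γ
  | 0 => 0
  | k + 1 => if abs (lastMax f k) ≤ abs (f k) then f k else lastMax f k

theorem lastMax_mem_signed (hf : ∀ i, f i ∈ signed Γ) (k : ℕ) : lastMax f k ∈ signed Γ := by
  induction k with
  | zero => exact zero_mem_signed
  | succ k ih =>
    rw [lastMax]
    split_ifs
    exacts [hf k, ih]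

theorem balance_lastMax (f : ℕ → Smax Γ) (k : ℕ) :
    Balance (f k) (lastMax f (k + 1) + -lastMax f k) := by
  rw [lastMax]
  split_ifs with hle
  · exact balance_add_of_abs_le ((abs_neg _).trans_le hle)
  · exact balance_add_neg_of_abs_le (not_le.1 hle).le

theorem abs_lastMax_le (h : ∀ i < k, abs (f i) ≤ M) : abs (lastMax f k) ≤ M := by
  induction k with
  | zero => exact map_zero (abs (Γ := Γ)) ▸ zero_le
  | succ k ih =>
    rw [lastMax]
    split_ifs
    exacts [h k k.lt_succ_self, ih fun i hi => h i (hi.trans k.lt_succ_self)]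

theorem lastMax_eq (hkl : k < l) (hle : ∀ i < k, abs (f i) ≤ abs (f k))
    (hlt : ∀ i, k < i → i < l → abs (f i) < abs (f k)) : lastMax f l = f k := by
  induction l, hkl using Nat.le_induction with
  | base => rw [lastMax, if_pos (abs_lastMax_le hle)]
  | succ l hkl ih =>
    have ih := ih fun i hki hil => hlt i hki (hil.trans l.lt_succ_self)
    rw [lastMax, ih, if_neg (hlt l hkl l.lt_succ_self).not_ge]

end LastMax

/-- A quotient of `F` by `Y ⊖ 1`, for a degree `b` at which a sign change of `F` ends. The division
is carried out from the low end in the degrees below `b` and from the high end in the others. -/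
noncomputable def quotientAt (b : ℕ) (F : (Smax Γ)[X]) : (Smax Γ)[X] :=
  ∑ k ∈ Finset.range F.natDegree, monomial k (if k < b then -lastMax F.coeff (k + 1)
    else lastMax (fun i => F.coeff (F.natDegree - i)) (F.natDegree - k))

section Division

variable {b : ℕ}

theorem coeff_quotientAt (b : ℕ) (F : (Smax Γ)[X]) (k : ℕ) : (quotientAt b F).coeff k =
    if k < F.natDegree then if k < b then -lastMax F.coeff (k + 1)
      else lastMax (fun i => F.coeff (F.natDegree - i)) (F.natDegree - k) else 0 := by
  simp [quotientAt, coeff_monomial]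

theorem coeff_quotientAt_of_lt (hb : b ≤ F.natDegree) (hk : k < b) :
    (quotientAt b F).coeff k = -lastMax F.coeff (k + 1) := by
  rw [coeff_quotientAt, if_pos (hk.trans_le hb), if_pos hk]

theorem coeff_quotientAt_of_le (hk : b ≤ k) : (quotientAt b F).coeff k =
    lastMax (fun i => F.coeff (F.natDegree - i)) (F.natDegree - k) := by
  rw [coeff_quotientAt, if_neg hk.not_gt]
  split_ifs with hkn
  · rfl
  · rw [Nat.sub_eq_zero_of_le (not_lt.1 hkn), lastMax]

theorem isSignedPoly_quotientAt (hF : IsSignedPoly F) (b : ℕ) :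
    IsSignedPoly (quotientAt b F) := fun k => by
  rw [coeff_quotientAt]
  split_ifs
  · exact neg_mem_signed (lastMax_mem_signed hF _)
  · exact lastMax_mem_signed (fun i => hF (F.natDegree - i)) _
  · exact zero_mem_signed

theorem abs_coeff_quotientAt_le (h : ∀ i, abs (F.coeff i) ≤ M) (k : ℕ) :
    abs ((quotientAt b F).coeff k) ≤ M := by
  rw [coeff_quotientAt]
  split_ifs
  · exact (abs_neg _).trans_le (abs_lastMax_le fun i _ => h i)
  · exact abs_lastMax_le fun i _ => h (F.natDegree - i)
  · exact map_zero (abs (Γ := Γ)) ▸ zero_le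

theorem balance_coeff_quotientAt_of_lt (hb : b ≤ F.natDegree) (hk : k < b) :
    Balance (F.coeff k) (((X + C (-1)) * quotientAt b F).coeff k) := by
  have hbal := balance_lastMax F.coeff k
  rw [coeff_X_add_C_neg_one_mul, coeff_quotientAt_of_lt hb hk, neg_neg, add_comm]
  rcases k with _ | k
  · simpa only [coeff_X_mul_zero, lastMax, neg_zero] using hbal
  · rwa [coeff_X_mul, coeff_quotientAt_of_lt hb (k.lt_succ_self.trans hk)]

theorem balance_coeff_quotientAt_of_gt (hk : b < k) :
    Balance (F.coeff k) (((X + C (-1)) * quotientAt b F).coeff k) := by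
  obtain ⟨k, rfl⟩ := Nat.exists_eq_add_one_of_ne_zero hk.ne_bot
  rw [coeff_X_add_C_neg_one_mul, coeff_X_mul, coeff_quotientAt_of_le (Nat.lt_succ_iff.1 hk),
    coeff_quotientAt_of_le hk.le]
  rcases le_or_gt (k + 1) F.natDegree with hkn | hkn
  · convert balance_lastMax (fun i => F.coeff (F.natDegree - i)) (F.natDegree - (k + 1)) using 3
    · simp only [Nat.sub_sub_self hkn]
    · lia
  · rw [coeff_eq_zero_of_natDegree_lt hkn, Nat.sub_eq_zero_of_le (Nat.lt_succ_iff.1 hkn),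
      Nat.sub_eq_zero_of_le hkn.le, lastMax, neg_zero, add_zero, zero_eq_mk, balance_mk]

variable {p : ℕ × ℕ} (hF₀ : F ≠ 0)

include hF₀

theorem lastMax_coeff_of_mem_consecutivePairs (hp : p ∈ consecutivePairs (sat 1 F)) :
    lastMax F.coeff p.2 = F.coeff p.1 := by
  obtain ⟨hp₁, -, hlt, hp⟩ := mem_consecutivePairs.1 hp
  have hmax := ((mem_sat_one hF₀).1 hp₁).2
  refine lastMax_eq hlt (fun i _ => hmax i) fun i hi hi' => (hmax i).lt_of_ne fun heq => ?_
  exact (hp i (mem_sat_one_of_abs_eq hF₀ hp₁ heq)).elim hi.not_ge hi'.not_ge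

theorem snd_le_natDegree (hp : p ∈ consecutivePairs (sat 1 F)) : p.2 ≤ F.natDegree :=
  le_natDegree_of_ne_zero ((mem_sat_one hF₀).1 (mem_consecutivePairs.1 hp).2.1).1

theorem coeff_quotientAt_snd_sub_one (hp : p ∈ consecutivePairs (sat 1 F)) (hpb : p.2 ≤ b)
    (hb : b ≤ F.natDegree) : (quotientAt b F).coeff (p.2 - 1) = -F.coeff p.1 := by
  have hlt := (mem_consecutivePairs.1 hp).2.2.1
  rw [coeff_quotientAt_of_lt hb (by lia), Nat.sub_add_cancel (by lia),
    lastMax_coeff_of_mem_consecutivePairs hF₀ hp]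

variable (hF : IsSignedPoly F) (hp : p ∈ signChanges 1 F)

include hF hp

theorem polyBalance_quotientAt : PolyBalance F ((X + C (-1)) * quotientAt p.2 F) := by
  rw [signChanges_one] at hp
  obtain ⟨hp, hjump⟩ := mem_jumps.1 hp
  obtain ⟨hp₁, hp₂, hlt, -⟩ := mem_consecutivePairs.1 hp
  have hb := snd_le_natDegree hF₀ hp
  intro k
  rcases lt_trichotomy k p.2 with hk | rfl | hk
  · exact balance_coeff_quotientAt_of_lt hb hk
  · -- The sign change makes the two divisions agree in degree `p.2`.
    have hneg : F.coeff p.2 = -F.coeff p.1 := by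
      refine (eq_or_eq_neg_of_abs_eq (hF _) (hF _) ?_).resolve_left hjump.symm
      simpa only [one_pow, mul_one] using abs_eq_of_mem_sat hp₂ hp₁
    have hlow : (X * quotientAt p.2 F).coeff p.2 = F.coeff p.2 := by
      rw [← Nat.sub_add_cancel (show 1 ≤ p.2 by lia), coeff_X_mul,
        Nat.sub_add_cancel (show 1 ≤ p.2 by lia), coeff_quotientAt_snd_sub_one hF₀ hp le_rfl hb,
        hneg]
    rw [coeff_X_add_C_neg_one_mul, hlow]
    refine balance_add_of_abs_le ((abs_neg _).trans_le ?_)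
    exact abs_coeff_quotientAt_le ((mem_sat_one hF₀).1 hp₂).2 p.2
  · exact balance_coeff_quotientAt_of_gt hk

omit hF in
theorem mem_signChanges_quotientAt (hpb : p.2 < b) (hb : b ≤ F.natDegree) :
    (p.2 - 1, p.2) ∈ signChanges 1 (quotientAt b F) := by
  rw [signChanges_one] at hp ⊢
  obtain ⟨hp, hjump⟩ := mem_jumps.1 hp
  obtain ⟨hp₁, hp₂, hlt, -⟩ := mem_consecutivePairs.1 hp
  have hmax := (mem_sat_one hF₀).1 hp₂
  have hfst := coeff_quotientAt_snd_sub_one hF₀ hp hpb.le hb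
  have hsnd : (quotientAt b F).coeff p.2 = -F.coeff p.2 := by
    rw [coeff_quotientAt_of_lt hb hpb,
      lastMax_eq p.2.lt_succ_self (fun i _ => hmax.2 i) fun i _ _ => by lia]
  have hG₀ : quotientAt b F ≠ 0 := by
    intro hG₀
    rw [hG₀, coeff_zero] at hsnd
    exact neg_ne_zero hmax.1 hsnd.symm
  have hsat : p.2 ∈ sat 1 (quotientAt b F) := (mem_sat_one hG₀).2
    ⟨hsnd ▸ neg_ne_zero hmax.1, hsnd ▸ abs_neg (F.coeff p.2) ▸ abs_coeff_quotientAt_le hmax.2⟩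
  refine mem_jumps.2 ⟨mem_consecutivePairs.2 ⟨?_, hsat, ?_, fun i _ => ?_⟩, ?_⟩
  · refine mem_sat_one_of_abs_eq hG₀ hsat ?_
    simpa [hfst, hsnd] using abs_eq_of_mem_sat hp₁ hp₂
  · lia
  · lia
  · simpa only [hfst, hsnd, neg_injective.ne_iff] using hjump

omit hp in
theorem exists_polyBalance_card_signChanges (hne : (signChanges 1 F).Nonempty) :
    ∃ G, IsSignedPoly G ∧ PolyBalance F ((X + C (-1)) * G) ∧
      (signChanges 1 F).card ≤ (signChanges 1 G).card + 1 := by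
  obtain ⟨q, hq, hq_max⟩ := Finset.exists_max_image (signChanges 1 F) Prod.snd hne
  refine ⟨quotientAt q.2 F, isSignedPoly_quotientAt hF _, polyBalance_quotientAt hF₀ hF hq, ?_⟩
  have hq_cons := (mem_jumps.1 hq).1
  have snd_inj : Set.InjOn Prod.snd (signChanges 1 F : Set (ℕ × ℕ)) :=
    injOn_snd_consecutivePairs.mono fun r hr => (mem_jumps.1 hr).1
  rw [← Finset.card_erase_add_one hq]
  refine Nat.add_le_add_right (Finset.card_le_card_of_injOn (fun r : ℕ × ℕ => (r.2 - 1, r.2))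
    (fun r hr => ?_) fun r hr s hs hrs => ?_) 1
  · obtain ⟨hrq, hr⟩ := Finset.mem_erase.1 hr
    exact mem_signChanges_quotientAt hF₀ hr
      ((hq_max r hr).lt_of_ne fun heq => hrq (snd_inj hr hq heq)) (snd_le_natDegree hF₀ hq_cons)
  · exact snd_inj (Finset.mem_of_mem_erase hr) (Finset.mem_of_mem_erase hs)
      (Prod.ext_iff.1 hrs).2

end Division

end DivisionLowerBound

/-! ### Multiplicities -/

section Multiplicity

variable {P Q : (Smax Γ)[X]} {a b : Smax Γ} {m : ℕ}

theorem PolyBalance.comp_C_mul_X (h : PolyBalance P Q) (a : Smax Γ) :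
    PolyBalance (P.comp (C a * X)) (Q.comp (C a * X)) := fun k => by
  rw [comp_C_mul_X_coeff, comp_C_mul_X_coeff, mul_comm, mul_comm (Q.coeff k)]
  exact balance_mul_left _ (h k)

theorem X_add_C_neg_mul_comp_C_mul_X (a b : Smax Γ) (Q : (Smax Γ)[X]) :
    ((X + C (-(a * b))) * Q).comp (C a * X) = (X + C (-b)) * (C a * Q.comp (C a * X)) := by
  rw [mul_comp, add_comp, X_comp, C_comp, ← mul_neg, C_mul]
  ring

theorem comp_C_mul_X_comp_C_mul_X (hab : a * b = 1) (P : (Smax Γ)[X]) :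
    (P.comp (C a * X)).comp (C b * X) = P := by
  ext k
  rw [comp_C_mul_X_coeff, comp_C_mul_X_coeff, mul_assoc, ← mul_pow, hab, one_pow, mul_one]

theorem ne_zero_of_isQuotientBy (hP : IsSignedPoly P) (hP₀ : P ≠ 0) (h : IsQuotientBy a P Q) :
    Q ≠ 0 := by
  obtain ⟨-, t, ht, ht₀, hbal⟩ := h
  rintro rfl
  refine mul_ne_zero (C_ne_zero.2 ht₀) hP₀ (Polynomial.ext fun k => ?_)
  refine eq_of_balance (hP.C_mul ht k) zero_mem_signed ?_
  simpa using hbal k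

theorem card_signChanges_lt_of_isQuotientBy (hP : IsSignedPoly P) (hP₀ : P ≠ 0)
    (ha : a ∈ signed Γ) (ha₀ : a ≠ 0) (h : IsQuotientBy a P Q) :
    (signChanges a Q).card < (signChanges a P).card := by
  have hQ₀ := ne_zero_of_isQuotientBy hP hP₀ h
  obtain ⟨hQ, t, ht, ht₀, hbal⟩ := h
  have hbal := PolyBalance.comp_C_mul_X hbal a
  have hcomp := X_add_C_neg_mul_comp_C_mul_X a 1 Q
  rw [mul_one] at hcomp
  rw [neg_eq_neg, hcomp] at hbal
  have hlt := card_signChanges_lt_of_polyBalance ((hP.C_mul ht).comp_C_mul_X ha)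
    ((hQ.comp_C_mul_X ha).C_mul ha) ?_ hbal
  · rwa [signChanges_C_mul ha ha₀, signChanges_comp_C_mul_X ha₀, signChanges_comp_C_mul_X ha₀,
      signChanges_C_mul ht ht₀] at hlt
  · obtain ⟨b, -, -, hab⟩ := exists_mul_eq_one ha ha₀
    refine mul_ne_zero (C_ne_zero.2 ha₀) fun hQa => hQ₀ ?_
    rw [← comp_C_mul_X_comp_C_mul_X hab Q, hQa, zero_comp]

theorem exists_isQuotientBy_card_signChanges (hP : IsSignedPoly P) (hP₀ : P ≠ 0)
    (ha : a ∈ signed Γ) (ha₀ : a ≠ 0) (hne : (signChanges a P).Nonempty) :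
    ∃ Q, IsQuotientBy a P Q ∧ (signChanges a P).card ≤ (signChanges a Q).card + 1 := by
  obtain ⟨b, hb, hb₀, hab⟩ := exists_mul_eq_one ha ha₀
  have hPa : P.comp (C a * X) ≠ 0 := fun hPa => hP₀ <| by
    rw [← comp_C_mul_X_comp_C_mul_X hab P, hPa, zero_comp]
  rw [← signChanges_comp_C_mul_X ha₀] at hne ⊢
  obtain ⟨G, hG, hbal, hcard⟩ :=
    exists_polyBalance_card_signChanges hPa (hP.comp_C_mul_X ha) hne
  refine ⟨C b * G.comp (C b * X), ⟨(hG.comp_C_mul_X hb).C_mul hb, 1, one_mem_signed,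
    one_ne_zero, ?_⟩, ?_⟩
  · rw [C_1, one_mul, neg_eq_neg, ← X_add_C_neg_mul_comp_C_mul_X, mul_comm b, hab,
      ← comp_C_mul_X_comp_C_mul_X hab P]
    exact hbal.comp_C_mul_X b
  · rwa [signChanges_C_mul hb hb₀, ← signChanges_comp_C_mul_X ha₀ (G.comp _),
      comp_C_mul_X_comp_C_mul_X (mul_comm a b ▸ hab)]

theorem multGE_iff_le_card_signChanges (hP : IsSignedPoly P) (hP₀ : P ≠ 0) (ha : a ∈ signed Γ)
    (ha₀ : a ≠ 0) : MultGE a m P ↔ m ≤ (signChanges a P).card := by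
  induction m generalizing P with
  | zero => simp [MultGE]
  | succ m ih =>
    rw [MultGE, isRootOf_iff_signChanges_nonempty hP hP₀ ha ha₀]
    constructor
    · rintro ⟨hne, rfl | ⟨Q, hQ, hm⟩⟩
      · exact hne.card_pos
      · rw [ih hQ.1 (ne_zero_of_isQuotientBy hP hP₀ hQ)] at hm
        exact hm.trans_lt (card_signChanges_lt_of_isQuotientBy hP hP₀ ha ha₀ hQ)
    · intro hm
      have hne : (signChanges a P).Nonempty := Finset.card_pos.1 (m.succ_pos.trans_le hm)
      obtain ⟨Q, hQ, hcard⟩ := exists_isQuotientBy_card_signChanges hP hP₀ ha ha₀ hne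
      refine ⟨hne, Or.inr ⟨Q, hQ, (ih hQ.1 (ne_zero_of_isQuotientBy hP hP₀ hQ)).2 ?_⟩⟩
      exact Nat.le_of_add_le_add_right (hm.trans hcard)

theorem isRootOf_zero_iff (hP : IsSignedPoly P) : IsRootOf (0 : Smax Γ) P ↔ X ∣ P := by
  rw [IsRootOf, ← coeff_zero_eq_eval_zero, X_dvd_iff]
  exact ⟨eq_of_balance (hP 0) zero_mem_signed, fun h => h ▸ balance_refl _⟩

theorem IsSignedPoly.X_mul (hQ : IsSignedPoly Q) : IsSignedPoly (X * Q)
  | 0 => coeff_X_mul_zero Q ▸ zero_mem_signed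
  | k + 1 => coeff_X_mul Q k ▸ hQ k

theorem isQuotientBy_zero_iff (hP : IsSignedPoly P) : IsQuotientBy (0 : Smax Γ) P Q ↔
    IsSignedPoly Q ∧ ∃ t ∈ signed Γ, t ≠ 0 ∧ C t * P = X * Q := by
  refine and_congr_right fun hQ => exists_congr fun t => and_congr_right fun ht =>
    and_congr_right fun _ => ?_
  rw [neg_eq_neg, neg_zero, C_0, add_zero]
  refine ⟨fun h => Polynomial.ext fun k => ?_, fun h k => h ▸ balance_refl _⟩
  exact eq_of_balance (hP.C_mul ht k) (hQ.X_mul k) (h k)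

theorem multGE_zero_iff_X_pow_dvd (hP : IsSignedPoly P) :
    MultGE (0 : Smax Γ) m P ↔ X ^ m ∣ P := by
  induction m generalizing P with
  | zero => simp [MultGE]
  | succ m ih =>
    simp only [MultGE, isRootOf_zero_iff hP, isQuotientBy_zero_iff hP]
    constructor
    · rintro ⟨hX, rfl | ⟨Q, ⟨hQ, t, ht, ht₀, hPQ⟩, hm⟩⟩
      · rwa [zero_add, pow_one]
      · obtain ⟨s, -, -, hts⟩ := exists_mul_eq_one ht ht₀
        have hP_eq : P = C s * (X * Q) := by
          rw [← hPQ, ← mul_assoc, ← C_mul, mul_comm s, hts, C_1, one_mul]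
        obtain ⟨R, rfl⟩ := (ih hQ).1 hm
        exact ⟨C s * R, by rw [hP_eq]; ring⟩
    · rintro ⟨R, rfl⟩
      have hXR : X ^ (m + 1) * R = X * (X ^ m * R) := by rw [pow_succ', mul_assoc]
      rw [hXR] at hP ⊢
      have hR : IsSignedPoly (X ^ m * R) := fun k => coeff_X_mul (X ^ m * R) k ▸ hP (k + 1)
      exact ⟨dvd_mul_right X _, Or.inr ⟨X ^ m * R,
        ⟨hR, 1, one_mem_signed, one_ne_zero, by rw [C_1, one_mul]⟩,
        (ih hR).2 (dvd_mul_right _ R)⟩⟩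

theorem mult_eq_of_multGE_iff {N : ℕ} (h : ∀ m, MultGE a m P ↔ m ≤ N) : mult a P = N :=
  le_antisymm (iSup₂_le fun m hm => by exact_mod_cast (h m).1 hm)
    (le_iSup₂_of_le (f := fun (m : ℕ) (_ : MultGE a m P) => (m : ℕ∞)) N ((h N).2 le_rfl) le_rfl)

theorem mult_eq_card_signChanges (hP : IsSignedPoly P) (hP₀ : P ≠ 0) (ha : a ∈ signed Γ)
    (ha₀ : a ≠ 0) : mult a P = (signChanges a P).card :=
  mult_eq_of_multGE_iff fun _ => multGE_iff_le_card_signChanges hP hP₀ ha ha₀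

theorem mult_zero_eq_natTrailingDegree (hP : IsSignedPoly P) (hP₀ : P ≠ 0) :
    mult (0 : Smax Γ) P = P.natTrailingDegree := by
  refine mult_eq_of_multGE_iff fun m => ?_
  rw [multGE_zero_iff_X_pow_dvd hP, X_pow_dvd_iff]
  refine ⟨le_natTrailingDegree hP₀, fun hm i hi => ?_⟩
  exact coeff_eq_zero_of_lt_natTrailingDegree (hi.trans_le hm)

end Multiplicity

/-! ### Counting the roots -/

section RootCount

variable {P : (Smax Γ)[X]} {a : Smax Γ} {p : ℕ × ℕ} {n : ℕ}

theorem sat_neg (hP : P ≠ 0) (ha : a ≠ 0) : sat (-a) P = sat a P := by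
  rw [sat_eq_maximizers hP (neg_ne_zero ha), sat_eq_maximizers hP ha, abs_neg]

theorem mul_neg_pow (x : Smax Γ) (a : Smax Γ) (k : ℕ) :
    x * (-a) ^ k = if Even k then x * a ^ k else -(x * a ^ k) := by
  split_ifs with hk
  · rw [hk.neg_pow]
  · rw [(Nat.not_even_iff_odd.1 hk).neg_pow, mul_neg]

theorem mem_signChanges_neg_iff (hP : IsSignedPoly P) (hP₀ : P ≠ 0) (ha : a ∈ signed Γ)
    (ha₀ : a ≠ 0) (hp : p ∈ consecutivePairs (sat a P)) :
    p ∈ signChanges (-a) P ↔ (p ∈ signChanges a P ↔ Even (p.2 - p.1)) := by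
  obtain ⟨hk, hl, hlt, -⟩ := mem_consecutivePairs.1 hp
  have hne : P.coeff p.2 * a ^ p.2 ≠ -(P.coeff p.2 * a ^ p.2) :=
    ne_neg_self (mul_pow_mem_signed hP ha _)
      (mul_ne_zero ((mem_sat hP₀ ha₀).1 hl).1 (pow_ne_zero _ ha₀))
  simp only [signChanges, mem_jumps, sat_neg hP₀ ha₀, hp, true_and, mul_neg_pow,
    Nat.even_sub hlt.le]
  rcases eq_or_eq_neg_of_mem_sat hP ha hk hl with h | h <;> rw [h] <;> by_cases Even p.1 <;>
    by_cases Even p.2 <;> simp [*, hne.symm]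

theorem card_signChanges_eq_sum (a : Smax Γ) (P : (Smax Γ)[X]) : (signChanges a P).card =
    ∑ p ∈ consecutivePairs (sat a P), if p ∈ signChanges a P then 1 else 0 := by
  rw [Finset.sum_boole, Finset.filter_mem_eq_inter, Finset.inter_eq_right.2]
  · rfl
  · exact fun p hp => (mem_jumps.1 hp).1

theorem card_signChanges_add_card_signChanges_neg (hP : IsSignedPoly P) (hP₀ : P ≠ 0)
    (ha : a ∈ signed Γ) (ha₀ : a ≠ 0) :
    (signChanges a P).card + (signChanges (-a) P).card =
      ∑ p ∈ consecutivePairs (sat a P),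
        if Even (p.2 - p.1) then (if p ∈ signChanges a P then 2 else 0) else 1 := by
  rw [card_signChanges_eq_sum, card_signChanges_eq_sum, sat_neg hP₀ ha₀, ← Finset.sum_add_distrib]
  refine Finset.sum_congr rfl fun p hp => ?_
  simp only [mem_signChanges_neg_iff hP hP₀ ha ha₀ hp]
  split_ifs <;> simp_all

theorem mem_signChanges_iff_eq_neg (hP : IsSignedPoly P) (hP₀ : P ≠ 0) (ha : a ∈ signed Γ)
    (ha₀ : a ≠ 0) (hp : p ∈ consecutivePairs (sat a P)) : p ∈ signChanges a P ↔
      P.coeff p.2 * a ^ p.2 = -(P.coeff p.1 * a ^ p.1) := by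
  obtain ⟨hk, hl, -⟩ := mem_consecutivePairs.1 hp
  have hne : P.coeff p.1 * a ^ p.1 ≠ -(P.coeff p.1 * a ^ p.1) :=
    ne_neg_self (mul_pow_mem_signed hP ha _)
      (mul_ne_zero ((mem_sat hP₀ ha₀).1 hk).1 (pow_ne_zero _ ha₀))
  simp only [signChanges, mem_jumps, hp, true_and]
  rcases eq_or_eq_neg_of_mem_sat hP ha hl hk with h | h <;> rw [h] <;> simp [hne]

/-- The condition on the dominant monomials of `P` at `a` under which `a` and `-a` together have
the greatest multiplicity that the degrees of these monomials allow. -/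
def HasTightGaps (a : Smax Γ) (P : (Smax Γ)[X]) : Prop :=
  ∀ p ∈ consecutivePairs (sat a P),
    p.2 - p.1 = 1 ∨ p.2 - p.1 = 2 ∧ P.coeff p.2 * a ^ p.2 = -(P.coeff p.1 * a ^ p.1)

theorem ite_even_le_card_Ioc (hp : p ∈ consecutivePairs (sat a P)) :
    (if Even (p.2 - p.1) then (if p ∈ signChanges a P then 2 else 0) else 1) ≤
      (Finset.Ioc p.1 p.2).card := by
  have := (mem_consecutivePairs.1 hp).2.2.1
  rw [Nat.card_Ioc]
  grind

theorem card_signChanges_add_card_signChanges_neg_le (hP : IsSignedPoly P) (hP₀ : P ≠ 0)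
    (ha : a ∈ signed Γ) (ha₀ : a ≠ 0) :
    (signChanges a P).card + (signChanges (-a) P).card ≤ (hull (sat a P)).card := by
  rw [card_signChanges_add_card_signChanges_neg hP hP₀ ha ha₀, card_hull]
  exact Finset.sum_le_sum fun p hp => ite_even_le_card_Ioc hp

theorem card_signChanges_add_card_signChanges_neg_eq_iff (hP : IsSignedPoly P) (hP₀ : P ≠ 0)
    (ha : a ∈ signed Γ) (ha₀ : a ≠ 0) :
    (signChanges a P).card + (signChanges (-a) P).card = (hull (sat a P)).card ↔
      HasTightGaps a P := by
  rw [card_signChanges_add_card_signChanges_neg hP hP₀ ha ha₀, card_hull,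
    Finset.sum_eq_sum_iff_of_le fun p hp => ite_even_le_card_Ioc hp]
  refine forall₂_congr fun p hp => ?_
  have := (mem_consecutivePairs.1 hp).2.2.1
  rw [Nat.card_Ioc, ← mem_signChanges_iff_eq_neg hP hP₀ ha ha₀ hp]
  grind

theorem coe_toNat_mult (hP : IsSignedPoly P) (hP₀ : P ≠ 0) (ha : a ∈ signed Γ) :
    ((mult a P).toNat : ℕ∞) = mult a P := by
  rcases eq_or_ne a 0 with rfl | ha₀
  · rw [mult_zero_eq_natTrailingDegree hP hP₀, ENat.toNat_natCast]
  · rw [mult_eq_card_signChanges hP hP₀ ha ha₀, ENat.toNat_natCast]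

theorem abs_mem_nonzeroCorners (hP₀ : P ≠ 0) (ha₀ : a ≠ 0) (h : (signChanges a P).Nonempty) :
    abs a ∈ Tmax.nonzeroCorners (absPoly P) := by
  obtain ⟨p, hp⟩ := h
  obtain ⟨hk, hl, hlt, -⟩ := mem_consecutivePairs.1 (mem_jumps.1 hp).1
  rw [Tmax.mem_nonzeroCorners, hull_nonempty, ← sat_eq_maximizers hP₀ ha₀]
  exact ⟨abs_ne_zero.2 ha₀, p.1, hk, p.2, hl, hlt.ne⟩

open Classical in
/-- `0` and the elements `±c` for the non-zero corners `c` of `|P|`, which include the roots of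
a signed polynomial `P`. -/
noncomputable def rootCandidates (P : (Smax Γ)[X]) : Finset (Smax Γ) :=
  insert 0 ((Tmax.finite_nonzeroCorners (absPoly P)).toFinset.biUnion
    fun c => {ofTmax c, -ofTmax c})

theorem mem_signed_of_mem_rootCandidates (ha : a ∈ rootCandidates P) : a ∈ signed Γ := by
  simp only [rootCandidates, Finset.mem_insert, Finset.mem_biUnion, Finset.mem_singleton] at ha
  rcases ha with rfl | ⟨c, -, rfl | rfl⟩
  · exact zero_mem_signed
  · exact ofTmax_mem_signed c
  · exact neg_mem_signed (ofTmax_mem_signed c)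

theorem mem_rootCandidates_of_mult_ne_zero (hP : IsSignedPoly P) (hP₀ : P ≠ 0)
    (ha : a ∈ signed Γ) (h : mult a P ≠ 0) : a ∈ rootCandidates P := by
  simp only [rootCandidates, Finset.mem_insert, Finset.mem_biUnion, Finset.mem_singleton,
    Set.Finite.mem_toFinset]
  refine or_iff_not_imp_left.2 fun ha₀ => ⟨abs a, ?_, eq_ofTmax_abs_or_eq_neg ha⟩
  rw [mult_eq_card_signChanges hP hP₀ ha ha₀, Nat.cast_ne_zero, Finset.card_ne_zero] at h
  exact abs_mem_nonzeroCorners hP₀ ha₀ h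

theorem sum_rootCandidates (f : Smax Γ → ℕ) (P : (Smax Γ)[X]) : ∑ a ∈ rootCandidates P, f a =
    f 0 + ∑ c ∈ (Tmax.finite_nonzeroCorners (absPoly P)).toFinset,
      (f (ofTmax c) + f (-ofTmax c)) := by
  classical
  have hC : ∀ c ∈ (Tmax.finite_nonzeroCorners (absPoly P)).toFinset, c ≠ 0 := fun c hc =>
    ((Set.Finite.mem_toFinset _).1 hc).1
  rw [rootCandidates, Finset.sum_insert, Finset.sum_biUnion]
  · refine congrArg _ (Finset.sum_congr rfl fun c hc => Finset.sum_pair ?_)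
    exact ne_neg_self (ofTmax_mem_signed c) (ofTmax_ne_zero (hC c hc))
  · refine fun c _ d _ hcd => Finset.disjoint_left.2 fun x hx hx' => hcd ?_
    have habs : ∀ e, x ∈ ({ofTmax e, -ofTmax e} : Finset (Smax Γ)) → abs x = e := fun e he => by
      rcases Finset.mem_insert.1 he with rfl | he
      · exact abs_ofTmax e
      · rw [Finset.mem_singleton.1 he, abs_neg, abs_ofTmax]
    rw [← habs c hx, habs d hx']
  · simp only [Finset.mem_biUnion, Finset.mem_insert, Finset.mem_singleton, not_exists, not_and,
      not_or]
    exact fun c hc => ⟨(ofTmax_ne_zero (hC c hc)).symm,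
      (neg_ne_zero (ofTmax_ne_zero (hC c hc))).symm⟩

theorem sum_toNat_mult (hP : IsSignedPoly P) (hP₀ : P ≠ 0) :
    ∑ a ∈ rootCandidates P, (mult a P).toNat = P.natTrailingDegree +
      ∑ c ∈ (Tmax.finite_nonzeroCorners (absPoly P)).toFinset,
        ((signChanges (ofTmax c) P).card + (signChanges (-ofTmax c) P).card) := by
  rw [sum_rootCandidates, mult_zero_eq_natTrailingDegree hP hP₀, ENat.toNat_natCast]
  refine congrArg _ (Finset.sum_congr rfl fun c hc => ?_)
  have hc₀ := ofTmax_ne_zero ((Set.Finite.mem_toFinset _).1 hc).1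
  rw [mult_eq_card_signChanges hP hP₀ (ofTmax_mem_signed c) hc₀, ENat.toNat_natCast,
    mult_eq_card_signChanges hP hP₀ (neg_mem_signed (ofTmax_mem_signed c)) (neg_ne_zero hc₀),
    ENat.toNat_natCast]

theorem hasRootsWithMult_iff_sum (hP : IsSignedPoly P) (hP₀ : P ≠ 0) :
    HasRootsWithMult P n ↔ ∑ a ∈ rootCandidates P, (mult a P).toNat = n := by
  classical
  rw [← exists_fin_family_iff (S := signed Γ) (fun a => mem_signed_of_mem_rootCandidates)]
  · refine exists_congr fun r => and_congr_right fun _ => forall₂_congr fun a ha => ?_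
    rw [← Nat.cast_inj (R := ℕ∞), coe_toNat_mult hP hP₀ ha]
  · intro a ha h
    refine mem_rootCandidates_of_mult_ne_zero hP hP₀ ha fun h₀ => h ?_
    rw [h₀, ENat.toNat_zero]

theorem natDegree_eq_natTrailingDegree_add_sum
    (hdiv : ∀ m : ℕ, 0 < m → ∀ a : Γ, ∃ b : Γ, m • b = a) (hP₀ : P ≠ 0) :
    P.natDegree = P.natTrailingDegree +
      ∑ c ∈ (Tmax.finite_nonzeroCorners (absPoly P)).toFinset, (hull (sat (ofTmax c) P)).card := by
  rw [← card_hull_support_add_natTrailingDegree P, add_comm, ← support_absPoly,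
    ← Tmax.sum_card_hull_maximizers hdiv]
  refine congrArg _ (Finset.sum_congr rfl fun c hc => ?_)
  rw [sat_eq_maximizers hP₀ (ofTmax_ne_zero ((Set.Finite.mem_toFinset _).1 hc).1), abs_ofTmax]

theorem hasRootsWithMult_natDegree_iff
    (hdiv : ∀ m : ℕ, 0 < m → ∀ a : Γ, ∃ b : Γ, m • b = a) (hP : IsSignedPoly P) (hP₀ : P ≠ 0) :
    HasRootsWithMult P P.natDegree ↔
      ∀ c ∈ Tmax.nonzeroCorners (absPoly P), HasTightGaps (ofTmax c) P := by
  have hC₀ : ∀ c ∈ (Tmax.finite_nonzeroCorners (absPoly P)).toFinset, ofTmax c ≠ 0 :=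
    fun c hc => ofTmax_ne_zero ((Set.Finite.mem_toFinset _).1 hc).1
  rw [hasRootsWithMult_iff_sum hP hP₀, sum_toNat_mult hP hP₀,
    natDegree_eq_natTrailingDegree_add_sum hdiv hP₀, Nat.add_left_cancel_iff,
    Finset.sum_eq_sum_iff_of_le fun c hc =>
      card_signChanges_add_card_signChanges_neg_le hP hP₀ (ofTmax_mem_signed c) (hC₀ c hc)]
  simp only [← Set.Finite.mem_toFinset (Tmax.finite_nonzeroCorners (absPoly P))]
  exact forall₂_congr fun c hc => card_signChanges_add_card_signChanges_neg_eq_iff hP hP₀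
    (ofTmax_mem_signed c) (hC₀ c hc)

end RootCount

/-! ### Saturation polynomials -/

section Saturation

variable {P : (Smax Γ)[X]} {r : Smax Γ} {c : Tmax Γ} {k l : ℕ}

theorem coeff_satPoly (P : (Smax Γ)[X]) (r : Smax Γ) (k : ℕ) : (satPoly P r).coeff k =
    if k ∈ sat r P then ofTmax (abs (P.eval r))⁻¹ * (P.coeff k * r ^ k) else 0 := by
  simp only [satPoly, finsetSum_coeff, coeff_monomial, Finset.sum_ite_eq', mul_assoc,
    mul_comm (r ^ k)]

theorem support_satPoly (hP₀ : P ≠ 0) (hr : r ≠ 0) : (satPoly P r).support = sat r P := by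
  ext k
  rw [mem_support_iff, coeff_satPoly, ite_ne_right_iff, and_iff_left_iff_imp]
  intro hk
  exact mul_ne_zero (ofTmax_ne_zero (inv_ne_zero (abs_eval_ne_zero hP₀ hr)))
    (mul_ne_zero ((mem_sat hP₀ hr).1 hk).1 (pow_ne_zero k hr))

theorem coeff_satPoly_eq_neg_iff (hP₀ : P ≠ 0) (hr : r ≠ 0) (hk : k ∈ sat r P)
    (hl : l ∈ sat r P) : (satPoly P r).coeff l = -(satPoly P r).coeff k ↔
      P.coeff l * r ^ l = -(P.coeff k * r ^ k) := by
  obtain ⟨u, -, -, hu⟩ := exists_mul_eq_one (ofTmax_mem_signed (abs (P.eval r))⁻¹)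
    (ofTmax_ne_zero (inv_ne_zero (abs_eval_ne_zero hP₀ hr)))
  rw [coeff_satPoly, coeff_satPoly, if_pos hk, if_pos hl, ← mul_neg,
    (IsUnit.of_mul_eq_one u hu).mul_right_inj]

theorem successiveDegrees_satPoly_iff (hP₀ : P ≠ 0) (hr : r ≠ 0) :
    SuccessiveDegrees (satPoly P r) k l ↔ (k, l) ∈ consecutivePairs (sat r P) := by
  rw [successiveDegrees_iff, support_satPoly hP₀ hr]

theorem hasTightGaps_iff_satPoly (hP₀ : P ≠ 0) (hr : r ≠ 0) : HasTightGaps r P ↔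
    ∀ k l, SuccessiveDegrees (satPoly P r) k l →
      l - k = 1 ∨ l - k = 2 ∧ (satPoly P r).coeff l = -(satPoly P r).coeff k := by
  simp only [HasTightGaps, Prod.forall, successiveDegrees_satPoly_iff hP₀ hr]
  refine forall₃_congr fun k l hkl => ?_
  obtain ⟨hk, hl, -⟩ := mem_consecutivePairs.1 hkl
  rw [coeff_satPoly_eq_neg_iff hP₀ hr hk hl]

theorem coeff_satPoly_eq_neg_iff_mul_mem_nonpos (hP : IsSignedPoly P) (hP₀ : P ≠ 0) (hc : c ≠ 0)
    (hk : k ∈ sat (ofTmax c) P) (hl : l ∈ sat (ofTmax c) P) :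
    (satPoly P (ofTmax c)).coeff l = -(satPoly P (ofTmax c)).coeff k ↔
      P.coeff l * P.coeff k ∈ nonpos Γ := by
  have hc₀ := ofTmax_ne_zero hc
  have hprod : P.coeff l * ofTmax c ^ l * (P.coeff k * ofTmax c ^ k) =
      P.coeff l * P.coeff k * ofTmax (c ^ (l + k)) := by
    rw [ofTmax_pow]
    ring
  rw [coeff_satPoly_eq_neg_iff hP₀ hc₀ hk hl, eq_neg_iff_mul_mem_nonpos
    (mul_pow_mem_signed hP (ofTmax_mem_signed c) l) (mul_pow_mem_signed hP (ofTmax_mem_signed c) k)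
    (mul_ne_zero ((mem_sat hP₀ hc₀).1 hl).1 (pow_ne_zero l hc₀)) (abs_eq_of_mem_sat hl hk),
    hprod, mul_ofTmax_mem_nonpos_iff (pow_ne_zero _ hc)]

end Saturation

end Smax

theorem mainTheorem9 {Γ : Type*} [AddCommGroup Γ] [LinearOrder Γ] [IsOrderedAddMonoid Γ]
    (hdiv : ∀ m : ℕ, 0 < m → ∀ a : Γ, ∃ b : Γ, m • b = a)
    (n : ℕ) (P : Polynomial (Smax Γ)) (hP : Smax.IsSignedPoly P) (hn : P.degree = n) :
    (Smax.HasRootsWithMult P n ↔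
      ∀ c : Tmax Γ, c ≠ 0 → Tmax.IsCorner (Smax.absPoly P) c →
        ∀ k l : ℕ, SuccessiveDegrees (Smax.satPoly P (Smax.ofTmax c)) k l →
          l - k = 1 ∨ (l - k = 2 ∧
            (Smax.satPoly P (Smax.ofTmax c)).coeff l =
              Smax.neg ((Smax.satPoly P (Smax.ofTmax c)).coeff k))) ∧
    (∀ c : Tmax Γ, c ≠ 0 → Tmax.IsCorner (Smax.absPoly P) c →
      ∀ k l : ℕ, SuccessiveDegrees (Smax.satPoly P (Smax.ofTmax c)) k l →
        ((Smax.satPoly P (Smax.ofTmax c)).coeff l =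
            Smax.neg ((Smax.satPoly P (Smax.ofTmax c)).coeff k) ↔
          P.coeff l * P.coeff k ∈ Smax.nonpos Γ)) := by
  have hP₀ : P ≠ 0 := by
    rintro rfl
    exact WithBot.bot_ne_natCast n (Polynomial.degree_zero.symm.trans hn)
  obtain rfl : n = P.natDegree := (Polynomial.natDegree_eq_of_degree_eq_some hn).symm
  constructor
  · rw [Smax.hasRootsWithMult_natDegree_iff hdiv hP hP₀]
    refine (forall_congr' fun c => and_imp).trans (forall₃_congr fun c hc _ => ?_)
    exact Smax.hasTightGaps_iff_satPoly hP₀ (Smax.ofTmax_ne_zero hc)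
  · intro c hc _ k l hkl
    rw [Smax.successiveDegrees_satPoly_iff hP₀ (Smax.ofTmax_ne_zero hc)] at hkl
    obtain ⟨hk, hl, -⟩ := mem_consecutivePairs.1 hkl
    exact Smax.coeff_satPoly_eq_neg_iff_mul_mem_nonpos hP hP₀ hc hk hl
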